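/- All graphs are finite, simple and undirected. The spectral radius $\rho(G)$ of a graph $G$ is the largest eigenvalue of its adjacency matrix. Let $S_4=K_{1,4}$ be the star with five vertices, $P_5$ the path with five vertices, and let $kS_4\cup 2P_5$ be the vertex-disjoint union of $k$ copies of $S_4$ and two copies of $P_5$. For $n\ge h+2$ let $S^+_{n,h}=K_h\vee(K_2\cup\overline{K}_{n-h-2})$, where $\vee$ denotes the join of two vertex-disjoint graphs; it has $n$ vertices. A graph is $H$-free if it has no (not necessarily induced) subgraph isomorphic to $H$, and $\mathrm{Ex}_{sp}(n,H)$ denotes the set of $H$-free graphs of order $n$ whose spectral radius is maximum among all $H$-free graphs of order $n$. Lemma. Suppose $k\ge 1$ and $n\ge\max\{2^{4(k+3)},\,(21k+38)^2\}$. Then, up to isomorphism, $$\mathrm{Ex}_{sp}(n,\,kS_4\cup 2P_5)=\{S^+_{n,\,k+3}\}.$$ -/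

import Mathlib

namespace SpectralForest

/-- The spectral radius of a finite graph: the largest (real) eigenvalue of its adjacency matrix,
see `isGreatest_rho`. -/
noncomputable def rho {V : Type*} [Fintype V] (G : SimpleGraph V) : ℝ := by
  classical exact sSup (spectrum ℝ (G.adjMatrix ℝ))

open Classical in
/-- On a nonempty vertex set the supremum in the definition of `rho` is a maximum. -/
theorem isGreatest_rho {V : Type*} [Fintype V] [Nonempty V] (G : SimpleGraph V) :
    IsGreatest (spectrum ℝ (G.adjMatrix ℝ)) (rho G) := by
  have hA : (G.adjMatrix ℝ).IsHermitian := by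
    rw [Matrix.IsHermitian, Matrix.conjTranspose_eq_transpose_of_trivial]
    exact G.transpose_adjMatrix
  have hne : (spectrum ℝ (G.adjMatrix ℝ)).Nonempty :=
    ⟨_, hA.eigenvalues_mem_spectrum_real (Classical.arbitrary V)⟩
  have hfin : (spectrum ℝ (G.adjMatrix ℝ)).Finite := Matrix.finite_real_spectrum
  exact ⟨hne.csSup_mem hfin, fun x hx => le_csSup hfin.bddAbove hx⟩

/-- The disjoint union `kG` of `k` copies of `G`. -/
def copies {V : Type*} (k : ℕ) (G : SimpleGraph V) : SimpleGraph (Fin k × V) where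
  Adj x y := x.1 = y.1 ∧ G.Adj x.2 y.2
  symm := ⟨fun _ _ h => ⟨h.1.symm, h.2.symm⟩⟩
  loopless := ⟨fun x h => G.loopless.irrefl x.2 h.2⟩

/-- The join `G ∨ H`: the disjoint union together with all edges between the two parts. -/
def join {V W : Type*} (G : SimpleGraph V) (H : SimpleGraph W) : SimpleGraph (V ⊕ W) :=
  SimpleGraph.sum G H ⊔ completeBipartiteGraph V W

/-- The star `S_m` with `m` leaves (so of order `m + 1`), centred at `0`. -/
def star (m : ℕ) : SimpleGraph (Fin (m + 1)) := SimpleGraph.starGraph 0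

/-- The graph `S⁺_{n,h} = K_h ∨ (K₂ ∪ \overline{K}_{n-h-2})`; it has order `n` when `h + 2 ≤ n`. -/
def sPlus (n h : ℕ) : SimpleGraph (Fin h ⊕ (Fin 2 ⊕ Fin (n - h - 2))) :=
  join (⊤ : SimpleGraph (Fin h))
    (SimpleGraph.sum (⊤ : SimpleGraph (Fin 2)) (⊥ : SimpleGraph (Fin (n - h - 2))))

/-- The forest `kS₄ ∪ 2P₅`, where `P₅` is the path on `5` vertices. -/
def forest (k : ℕ) : SimpleGraph ((Fin k × Fin 5) ⊕ (Fin 2 × Fin 5)) :=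
  SimpleGraph.sum (copies k (star 4)) (copies 2 (SimpleGraph.pathGraph 5))

/-- The set of `H`-free graphs on `n` labelled vertices whose spectral radius is maximum among all
`H`-free graphs of order `n`. Here `H.Free G` says that `G` has no (not necessarily induced)
subgraph isomorphic to `H`. -/
def exSp {W : Type*} (n : ℕ) (H : SimpleGraph W) : Set (SimpleGraph (Fin n)) :=
  {G | H.Free G ∧ ∀ G' : SimpleGraph (Fin n), H.Free G' → rho G' ≤ rho G}

end SpectralForest

/-!
Write `h = k + 3` and let `G` be a `kS₄ ∪ 2P₅`-free graph of order `n` whose spectral radius `r` is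
at least that of `S⁺ = S⁺_{n,h}`; comparison with the complete bipartite graph `K_{h,n-h}` gives
`r² ≥ h(n - h)` (`le_sq_rho_sPlus`). Since `S⁺` is itself free of the forest
(`forest_free_sPlus`), it suffices to show that `G` is isomorphic to `S⁺` (`nonempty_iso_sPlus`).
Fix a nonnegative eigenvector `x` for `r` with maximum `1`, attained at `v`.

*A sparse remainder.* Removing `k` vertices of large degree (which can serve as centres of stars)
and the vertices of one further path leaves a graph without paths on five vertices
(`exists_hitting_set`). In such a graph every vertex has at most one neighbour of degree at least
four (`card_inter_centers_le_one`). So outside a set `C` of at most `k + 5` vertices all weights are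
small, except at vertices (`centers`) whose outer degrees sum to at most `n`.

*The core.* The equation `r² = ∑ codeg(v,u) x(u)` then shows that almost all of `h n` comes from `v`
and the vertices `u` sharing at least `5h` neighbours with `v`. Fewer than `h - 1` such `u` are not
enough. With `h` or more of them, either two of them also share many neighbours, which produces the
forest greedily (`codeg_lt_of_free`), or their neighbourhoods inside that of `v` are almost disjoint
and the sum is too small. So together with `v` they form a set `L` of exactly `h` vertices, of
weight at least `3/4`, and all but at most `n/4` vertices are adjacent to all of `L`
(`exists_core`).

*Comparison.* Now `L` provides `k` stars and one path with one vertex to spare. So there is no path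
on five vertices meeting `L` at most once (`isContained_of_common`); in particular there is at most
one edge among the vertices joined to all of `L` (`exists_pair_of_full`). Let `S` be the copy of
`S⁺` with core `L` containing this edge (`coreGraph`). Passing from `G` to `S` removes the edges
outside `L` at the set `R` of vertices missing part of `L`, and adds the missing edges to `L`. The
gain in the quadratic form at `x` exceeds the loss by a multiple of `∑_{u ∈ R} x(u)`
(`quadForm_add_le`). Hence `x` attains the maximum `rho S` of the Rayleigh quotient of `S`, so it is
an eigenvector of `S` and therefore positive; this forces `R = ∅` and `G = S`
(`exists_eq_coreGraph`).
-/

namespace SpectralForest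

/-! ### The Rayleigh quotient and nonnegative eigenvectors -/

section Spectral

variable {V : Type*} [Fintype V]

theorem rho_eq_of_iso {W : Type*} [Fintype W] {G : SimpleGraph V} {H : SimpleGraph W}
    (e : G ≃g H) : rho G = rho H := by
  classical
  have h : H.adjMatrix ℝ = Matrix.reindexAlgEquiv ℝ ℝ e.toEquiv (G.adjMatrix ℝ) := by
    ext a b
    have : G.Adj (e.symm a) (e.symm b) ↔ H.Adj a b := e.symm.map_adj_iff
    simp only [Matrix.coe_reindexAlgEquiv, Matrix.reindex_apply, Matrix.submatrix_apply,
      SimpleGraph.adjMatrix_apply]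
    exact if_congr this.symm rfl rfl
  have h2 : spectrum ℝ (H.adjMatrix ℝ) = spectrum ℝ (G.adjMatrix ℝ) := by
    rw [h]
    exact AlgEquiv.spectrum_eq (Matrix.reindexAlgEquiv ℝ ℝ e.toEquiv) (G.adjMatrix ℝ)
  unfold rho
  congr 1
  convert h2.symm

theorem posSemidef_rho_sub_adjMatrix [DecidableEq V] [Nonempty V] (G : SimpleGraph V)
    [DecidableRel G.Adj] :
    (algebraMap ℝ (Matrix V V ℝ) (rho G) - G.adjMatrix ℝ).PosSemidef := by
  have hle : ∀ {b : ℝ}, b ∈ spectrum ℝ (G.adjMatrix ℝ) → b ≤ rho G := fun {b} hb =>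
    (isGreatest_rho G).2 (by convert hb)
  rw [Matrix.posSemidef_iff_isHermitian_and_spectrum_nonneg]
  constructor
  · refine Matrix.IsHermitian.sub ?_ ?_
    · rw [Matrix.algebraMap_eq_diagonal]
      exact Matrix.isHermitian_diagonal _
    · rw [Matrix.IsHermitian, Matrix.conjTranspose_eq_transpose_of_trivial]
      exact G.transpose_adjMatrix
  · rw [← spectrum.singleton_sub_eq]
    rintro _ ⟨a, ha, b, hb, rfl⟩
    rw [Set.mem_singleton_iff] at ha
    subst ha
    simpa using hle hb

/-- The quadratic form `∑ A(u,w) x(u) x(w)` of the adjacency matrix of `G`. -/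
def quadForm (G : SimpleGraph V) [DecidableRel G.Adj] (x : V → ℝ) : ℝ :=
  ∑ u, ∑ w, if G.Adj u w then x u * x w else 0

theorem dotProduct_rho_sub_adjMatrix [DecidableEq V] (G : SimpleGraph V) [DecidableRel G.Adj]
    (x : V → ℝ) :
    Star.star x ⬝ᵥ (algebraMap ℝ (Matrix V V ℝ) (rho G) - G.adjMatrix ℝ).mulVec x =
      rho G * ∑ u, x u ^ 2 - quadForm G x := by
  rw [Matrix.sub_mulVec, dotProduct_sub, Algebra.algebraMap_eq_smul_one, Matrix.smul_mulVec,
    Matrix.one_mulVec, star_trivial, dotProduct_smul]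
  simp only [dotProduct, Matrix.mulVec, SimpleGraph.adjMatrix_apply, quadForm, smul_eq_mul,
    Finset.mul_sum]
  congr 1
  · exact Finset.sum_congr rfl fun u _ => by ring
  · refine Finset.sum_congr rfl fun u _ => Finset.sum_congr rfl fun w _ => ?_
    split_ifs <;> simp

theorem quadForm_le [Nonempty V] (G : SimpleGraph V) [DecidableRel G.Adj] (x : V → ℝ) :
    quadForm G x ≤ rho G * ∑ u, x u ^ 2 := by
  classical
  have := (posSemidef_rho_sub_adjMatrix G).dotProduct_mulVec_nonneg x
  rw [dotProduct_rho_sub_adjMatrix] at this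
  linarith

theorem eigenvector_of_le_quadForm [Nonempty V] (G : SimpleGraph V) [DecidableRel G.Adj]
    (x : V → ℝ) (hx : rho G * ∑ u, x u ^ 2 ≤ quadForm G x) (u : V) :
    ∑ w ∈ G.neighborFinset u, x w = rho G * x u := by
  classical
  have h := (posSemidef_rho_sub_adjMatrix G).dotProduct_mulVec_zero_iff x
  rw [dotProduct_rho_sub_adjMatrix] at h
  have h2 := congrFun (h.1 (by linarith [quadForm_le G x])) u
  rw [Matrix.sub_mulVec, Algebra.algebraMap_eq_smul_one, Matrix.smul_mulVec, Matrix.one_mulVec,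
    Pi.sub_apply, SimpleGraph.adjMatrix_mulVec_apply] at h2
  simp only [Pi.smul_apply, smul_eq_mul, Pi.zero_apply] at h2
  linarith

theorem quadForm_eq_of_eigenvector (G : SimpleGraph V) [DecidableRel G.Adj]
    {x : V → ℝ} {r : ℝ} (hx : ∀ u, ∑ w ∈ G.neighborFinset u, x w = r * x u) :
    quadForm G x = r * ∑ u, x u ^ 2 := by
  rw [quadForm, Finset.mul_sum]
  refine Finset.sum_congr rfl fun u _ => ?_
  rw [← Finset.sum_filter, ← Finset.mul_sum, ← SimpleGraph.neighborFinset_eq_filter, hx]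
  ring

/-- The absolute value of an eigenvector for `rho G` is again one, since it attains the maximum of
the Rayleigh quotient; it is scaled here to have maximum `1`. -/
theorem exists_nonneg_eigenvector [Nonempty V] (G : SimpleGraph V) [DecidableRel G.Adj] :
    ∃ x : V → ℝ, (∀ u, 0 ≤ x u) ∧ (∀ u, x u ≤ 1) ∧ (∃ v, x v = 1) ∧
      ∀ u, ∑ w ∈ G.neighborFinset u, x w = rho G * x u := by
  classical
  have hs : rho G ∈ spectrum ℝ (G.adjMatrix ℝ) := by
    convert (isGreatest_rho G).1
  rw [← Matrix.spectrum_toLin'] at hs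
  obtain ⟨y, hy⟩ := (Module.End.HasEigenvalue.of_mem_spectrum hs).exists_hasEigenvector
  have hy1 : ∀ u, ∑ w ∈ G.neighborFinset u, y w = rho G * y u := fun u => by
    have := congrFun hy.apply_eq_smul u
    rwa [Matrix.toLin'_apply, SimpleGraph.adjMatrix_mulVec_apply] at this
  have habs : ∀ u, ∑ w ∈ G.neighborFinset u, |y w| = rho G * |y u| := by
    refine eigenvector_of_le_quadForm G (fun u => |y u|) ?_
    simp only [sq_abs]
    rw [← quadForm_eq_of_eigenvector G hy1]
    refine Finset.sum_le_sum fun u _ => Finset.sum_le_sum fun w _ => ?_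
    split_ifs
    · rw [← abs_mul]
      exact le_abs_self _
    · exact le_rfl
  obtain ⟨v, hv⟩ := Finite.exists_max fun u => |y u|
  have hpos : 0 < |y v| := by
    obtain ⟨u, hu⟩ := Function.ne_iff.1 hy.2
    exact (abs_pos.2 hu).trans_le (hv u)
  refine ⟨fun u => |y u| / |y v|, fun u => by positivity, fun u => (div_le_one hpos).2 (hv u),
    ⟨v, div_self hpos.ne'⟩, fun u => ?_⟩
  rw [← Finset.sum_div, habs, mul_div_assoc]

end Spectral

/-! ### Embedding the forest greedily -/

section Embedding

variable {V : Type*}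

/-- `p` lists the vertices of a (not necessarily induced) path on five vertices of `G`. -/
def IsP5 (G : SimpleGraph V) (p : Fin 5 → V) : Prop :=
  Function.Injective p ∧ ∀ i : Fin 4, G.Adj (p i.castSucc) (p i.succ)

theorem isP5_of {G : SimpleGraph V} {a b c d e : V} (hab : G.Adj a b) (hbc : G.Adj b c)
    (hcd : G.Adj c d) (hde : G.Adj d e) (hac : a ≠ c) (had : a ≠ d) (hae : a ≠ e) (hbd : b ≠ d)
    (hbe : b ≠ e) (hce : c ≠ e) : IsP5 G ![a, b, c, d, e] := by
  constructor
  · have h1 := hab.ne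
    have h2 := hbc.ne
    have h3 := hcd.ne
    have h4 := hde.ne
    intro i j hij
    fin_cases i <;> fin_cases j <;> first | rfl | (exfalso; simp_all)
  · intro i
    fin_cases i <;> assumption

variable [Fintype V]

theorem exists_adj_notMem (G : SimpleGraph V) [DecidableRel G.Adj] {u : V} {A : Finset V}
    (h : A.card < G.degree u) : ∃ w, G.Adj u w ∧ w ∉ A := by
  rw [← G.card_neighborFinset_eq_degree] at h
  obtain ⟨w, hw, hA⟩ := Finset.exists_mem_notMem_of_card_lt_card h
  exact ⟨w, by simpa using hw, hA⟩

variable [DecidableEq V]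

/-- Disjoint stars can be attached to prescribed centres of large degree: there are enough
neighbours left for Hall's condition to hold trivially. -/
theorem isContained_of_paths {k : ℕ} {G : SimpleGraph V} [DecidableRel G.Adj]
    {p : Fin 2 → Fin 5 → V} (hp : ∀ i, IsP5 G (p i)) (hdisj : ∀ i j, p 0 i ≠ p 1 j)
    {C : Finset V} (hC : k ≤ C.card) (hCp : ∀ i j, p i j ∉ C)
    (hdeg : ∀ c ∈ C, 5 * k + 10 ≤ G.degree c) : (forest k).IsContained G := by
  obtain ⟨C', hC', hcard⟩ := Finset.exists_subset_card_eq hC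
  let c : Fin k → V := fun i => (C'.equivFinOfCardEq hcard).symm i
  have hc : Function.Injective c :=
    Subtype.val_injective.comp (C'.equivFinOfCardEq hcard).symm.injective
  have hcC : ∀ i, c i ∈ C' := fun i => ((C'.equivFinOfCardEq hcard).symm i).2
  let P : Finset V := Finset.univ.image fun ij : Fin 2 × Fin 5 => p ij.1 ij.2
  have hP : P.card ≤ 10 := Finset.card_image_le.trans (by simp)
  have hall : ∀ s : Finset (Fin k × Fin 4), s.card ≤
      (s.biUnion fun ij => G.neighborFinset (c ij.1) \ (C' ∪ P)).card := by
    intro s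
    rcases s.eq_empty_or_nonempty with rfl | ⟨ij, hij⟩
    · simp
    have h1 : s.card ≤ k * 4 := (Finset.card_le_univ s).trans (by simp)
    have h2 := Finset.card_le_card (Finset.subset_biUnion_of_mem
      (fun ij : Fin k × Fin 4 => G.neighborFinset (c ij.1) \ (C' ∪ P)) hij)
    have h3 := Finset.le_card_sdiff (C' ∪ P) (G.neighborFinset (c ij.1))
    have h4 := Finset.card_union_le C' P
    have h5 := hdeg _ (hC' (hcC ij.1))
    rw [G.card_neighborFinset_eq_degree] at h3
    omega
  obtain ⟨f, hf, hfm⟩ := (Finset.all_card_le_biUnion_card_iff_exists_injective _).1 hall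
  have hfadj : ∀ i j, G.Adj (c i) (f (i, j)) := fun i j => by
    have := (Finset.mem_sdiff.1 (hfm (i, j))).1
    simpa using this
  have hfC : ∀ ij, f ij ∉ C' := fun ij h =>
    (Finset.mem_sdiff.1 (hfm ij)).2 (Finset.mem_union_left _ h)
  have hfP : ∀ ij a b, f ij ≠ p a b := fun ij a b h =>
    (Finset.mem_sdiff.1 (hfm ij)).2 (Finset.mem_union_right _
      (Finset.mem_image.2 ⟨(a, b), Finset.mem_univ _, h.symm⟩))
  have hCp' : ∀ i a b, c i ≠ p a b := fun i a b h => hCp a b (h ▸ hC' (hcC i))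
  let g : Fin k × Fin 5 → V := fun ij => Fin.cases (c ij.1) (fun j => f (ij.1, j)) ij.2
  have hg0 : ∀ i, g (i, 0) = c i := fun i => rfl
  have hgs : ∀ i j, g (i, Fin.succ j) = f (i, j) := fun i j => rfl
  let F : (Fin k × Fin 5) ⊕ (Fin 2 × Fin 5) → V := Sum.elim g fun ij => p ij.1 ij.2
  refine ⟨⟨⟨F, ?_⟩, ?_⟩⟩
  · rintro (⟨i, a⟩ | ⟨i, a⟩) (⟨j, b⟩ | ⟨j, b⟩) hab
    · obtain ⟨hij, hadj⟩ : (copies k (star 4)).Adj (i, a) (j, b) := by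
        simpa [forest] using hab
      dsimp only at hij hadj
      subst hij
      have hab' : a ≠ b ∧ (a = 0 ∨ b = 0) := SimpleGraph.starGraph_adj.1 hadj
      obtain ⟨hne, rfl | rfl⟩ := hab'
      · obtain ⟨b, rfl⟩ := Fin.exists_succ_eq.2 hne.symm
        exact hfadj i b
      · obtain ⟨a, rfl⟩ := Fin.exists_succ_eq.2 hne
        exact (hfadj i a).symm
    · simp [forest] at hab
    · simp [forest] at hab
    · obtain ⟨hij, hadj⟩ : (copies 2 (SimpleGraph.pathGraph 5)).Adj (i, a) (j, b) := by
        simpa [forest] using hab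
      dsimp only at hij hadj
      subst hij
      change G.Adj (p i a) (p i b)
      rw [SimpleGraph.pathGraph_adj] at hadj
      have key : ∀ a b : Fin 5, (a : ℕ) + 1 = b → G.Adj (p i a) (p i b) := by
        intro a b h
        have h2 := (hp i).2 ⟨a, by omega⟩
        rwa [show Fin.succ ⟨(a : ℕ), _⟩ = b from Fin.ext h] at h2
      rcases hadj with h | h
      · exact key a b h
      · exact (key b a h).symm
  · rintro (⟨i, a⟩ | ⟨i, a⟩) (⟨j, b⟩ | ⟨j, b⟩) hab
    · change g (i, a) = g (j, b) at hab
      congr 1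
      rcases Fin.eq_zero_or_eq_succ a with rfl | ⟨a, rfl⟩ <;>
        rcases Fin.eq_zero_or_eq_succ b with rfl | ⟨b, rfl⟩
      · rw [hg0, hg0] at hab
        rw [hc hab]
      · rw [hg0, hgs] at hab
        exact absurd (hab ▸ hcC i) (hfC _)
      · rw [hg0, hgs] at hab
        exact absurd (hab ▸ hcC j) (hfC _)
      · rw [hgs, hgs] at hab
        have := hf hab
        simp only [Prod.mk.injEq] at this
        rw [this.1, this.2]
    · change g (i, a) = p j b at hab
      exfalso
      rcases Fin.eq_zero_or_eq_succ a with rfl | ⟨a, rfl⟩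
      · exact hCp' _ _ _ hab
      · exact hfP _ _ _ hab
    · change p i a = g (j, b) at hab
      exfalso
      rcases Fin.eq_zero_or_eq_succ b with rfl | ⟨b, rfl⟩
      · exact hCp' _ _ _ hab.symm
      · exact hfP _ _ _ hab.symm
    · change p i a = p j b at hab
      have hij : i = j := by
        by_contra hne
        fin_cases i <;> fin_cases j <;> first | exact hne rfl | exact hdisj _ _ hab |
          exact hdisj _ _ hab.symm
      subst hij
      rw [(hp i).1 hab]

/-- The number of common neighbours of `u` and `v`; this is the degree when `u = v`. -/
def codeg (G : SimpleGraph V) [DecidableRel G.Adj] (u v : V) : ℕ :=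
  (G.neighborFinset u ∩ G.neighborFinset v).card

theorem codeg_le_degree_left (G : SimpleGraph V) [DecidableRel G.Adj] (u v : V) :
    codeg G u v ≤ G.degree u :=
  (Finset.card_le_card Finset.inter_subset_left).trans_eq (G.card_neighborFinset_eq_degree u)

theorem codeg_le_degree_right (G : SimpleGraph V) [DecidableRel G.Adj] (u v : V) :
    codeg G u v ≤ G.degree v :=
  (Finset.card_le_card Finset.inter_subset_right).trans_eq (G.card_neighborFinset_eq_degree v)

theorem codeg_self (G : SimpleGraph V) [DecidableRel G.Adj] (u : V) :
    codeg G u u = G.degree u := by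
  rw [codeg, Finset.inter_self, G.card_neighborFinset_eq_degree]

theorem exists_common_adj_notMem (G : SimpleGraph V) [DecidableRel G.Adj] {u v : V} {A : Finset V}
    (h : A.card < codeg G u v) : ∃ w, G.Adj u w ∧ G.Adj v w ∧ w ∉ A := by
  obtain ⟨w, hw, hA⟩ := Finset.exists_mem_notMem_of_card_lt_card h
  rw [Finset.mem_inter, G.mem_neighborFinset, G.mem_neighborFinset] at hw
  exact ⟨w, hw.1, hw.2, hA⟩

/-- Two vertices with many common neighbours are the second and fourth vertex of a path on five
vertices avoiding a given small set. -/
theorem exists_isP5_of_codeg (G : SimpleGraph V) [DecidableRel G.Adj] {u v : V} {A : Finset V}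
    (huv : u ≠ v) (h : A.card + 5 ≤ codeg G u v) (hu : u ∉ A) (hv : v ∉ A) :
    ∃ p, IsP5 G p ∧ ∀ i, p i ∉ A := by
  have hdu := codeg_le_degree_left G u v
  have hdv := codeg_le_degree_right G u v
  obtain ⟨c, huc, hvc, hc⟩ := exists_common_adj_notMem G (u := u) (v := v) (A := A) (by omega)
  have h1 : (insert c (insert v A)).card ≤ A.card + 2 := by grind
  obtain ⟨a, hua, ha⟩ := exists_adj_notMem G (u := u) (A := insert c (insert v A)) (by omega)
  have h2 : (insert a (insert c (insert u A))).card ≤ A.card + 3 := by grind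
  obtain ⟨e, hve, he⟩ := exists_adj_notMem G (u := v) (A := insert a (insert c (insert u A)))
    (by omega)
  simp only [Finset.mem_insert, not_or] at ha he
  refine ⟨_, isP5_of hua.symm huc hvc.symm hve ha.1 ha.2.1 (Ne.symm he.1) huv
    (Ne.symm he.2.2.1) (Ne.symm he.2.1), fun i => ?_⟩
  fin_cases i
  · exact ha.2.2
  · exact hu
  · exact hc
  · exact hv
  · exact he.2.2.2

/-- A path on five vertices, a disjoint pair of vertices with many common neighbours, and `k` more
vertices of large degree give a copy of `kS₄ ∪ 2P₅`. -/
theorem isContained_of_isP5_of_codeg {k : ℕ} {G : SimpleGraph V} [DecidableRel G.Adj]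
    {p : Fin 5 → V} (hp : IsP5 G p) {u v : V} (huv : u ≠ v)
    (hcodeg : 5 * k + 15 ≤ codeg G u v) {C : Finset V} (hC : k ≤ C.card)
    (hdeg : ∀ c ∈ C, 5 * k + 15 ≤ G.degree c) (hpC : ∀ i, p i ∉ C) (hpu : ∀ i, p i ≠ u)
    (hpv : ∀ i, p i ≠ v) (hu : u ∉ C) (hv : v ∉ C) : (forest k).IsContained G := by
  obtain ⟨C', hC', hcard⟩ := Finset.exists_subset_card_eq hC
  have hA : (C' ∪ Finset.univ.image p).card ≤ k + 5 := by
    refine (Finset.card_union_le _ _).trans ?_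
    have : (Finset.univ.image p).card ≤ 5 := Finset.card_image_le.trans (by simp)
    omega
  obtain ⟨q, hq, hqA⟩ := exists_isP5_of_codeg G (A := C' ∪ Finset.univ.image p) huv (by omega)
    (by
      simp only [Finset.mem_union, Finset.mem_image, Finset.mem_univ, true_and, not_or, not_exists]
      exact ⟨fun h => hu (hC' h), hpu⟩)
    (by
      simp only [Finset.mem_union, Finset.mem_image, Finset.mem_univ, true_and, not_or, not_exists]
      exact ⟨fun h => hv (hC' h), hpv⟩)
  simp only [Finset.mem_union, Finset.mem_image, Finset.mem_univ, true_and, not_or,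
    not_exists] at hqA
  refine isContained_of_paths (p := ![p, q]) (C := C') (Fin.forall_fin_two.2 ⟨hp, hq⟩)
    (fun i j => (hqA j).2 i) hcard.ge
    (Fin.forall_fin_two.2 ⟨fun j h => hpC j (hC' h), fun j => (hqA j).1⟩) fun c hc => ?_
  have := hdeg c (hC' hc)
  omega

/-- If `L` consists of `k + 3` vertices with many common neighbours, then `k + 2` of them suffice
for the stars and one of the paths, so that no path on five vertices meets `L` at most once. -/
theorem isContained_of_common {k : ℕ} {G : SimpleGraph V} [DecidableRel G.Adj]
    {L : Finset V} (hL : L.card = k + 3)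
    (hcodeg : ∀ u ∈ L, ∀ v ∈ L, 5 * k + 15 ≤ codeg G u v) {p : Fin 5 → V} (hp : IsP5 G p)
    (l : V) (hpl : ∀ i, p i ∈ L → p i = l) : (forest k).IsContained G := by
  have h1 : k + 2 ≤ (L.erase l).card := by
    have := Finset.pred_card_le_card_erase (s := L) (a := l)
    omega
  have hpL : ∀ i, p i ∉ L.erase l := fun i h =>
    (Finset.mem_erase.1 h).1 (hpl i (Finset.mem_erase.1 h).2)
  obtain ⟨u, hu, v, hv, huv⟩ := Finset.one_lt_card.1 (show 1 < (L.erase l).card by omega)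
  refine isContained_of_isP5_of_codeg (C := ((L.erase l).erase u).erase v) hp huv
    (hcodeg u (Finset.mem_of_mem_erase hu) v (Finset.mem_of_mem_erase hv)) ?_ ?_ ?_ ?_ ?_ ?_ ?_
  · have h2 := Finset.card_erase_of_mem hu
    have h3 := Finset.pred_card_le_card_erase (s := (L.erase l).erase u) (a := v)
    omega
  · intro c hc
    have hc' : c ∈ L := Finset.mem_of_mem_erase (Finset.mem_of_mem_erase
      (Finset.mem_of_mem_erase hc))
    rw [← codeg_self]
    exact hcodeg c hc' c hc'
  · exact fun i h => hpL i (Finset.mem_of_mem_erase (Finset.mem_of_mem_erase h))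
  · exact fun i h => hpL i (h ▸ hu)
  · exact fun i h => hpL i (h ▸ hv)
  · simp
  · simp

end Embedding

/-! ### The graph `S⁺` -/

section SPlus

theorem sPlus_adj_outside {n h : ℕ} {a b : Fin h ⊕ (Fin 2 ⊕ Fin (n - h - 2))}
    (hab : (sPlus n h).Adj a b)
    (ha : ∀ i, a ≠ Sum.inl i) (hb : ∀ i, b ≠ Sum.inl i) :
    (∃ i, a = Sum.inr (Sum.inl i)) ∧ ∃ i, b = Sum.inr (Sum.inl i) := by
  rcases a with a | a | a <;> rcases b with b | b | b <;>
    simp_all [sPlus, join]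

/-- The only edge of `S⁺` outside the core `K_h` has two vertices, so that every five-vertex path
meets the core at least twice. -/
theorem exists_ne_mem_core_of_isP5 {n h : ℕ} {p : Fin 5 → Fin h ⊕ (Fin 2 ⊕ Fin (n - h - 2))}
    (hp : IsP5 (sPlus n h) p) :
    ∃ f : Fin 2 → Fin h, Function.Injective f ∧ ∀ i, ∃ j, p j = Sum.inl (f i) := by
  by_contra hcon
  have huniq : ∀ i j a b, p i = Sum.inl a → p j = Sum.inl b → a = b := by
    intro i j a b hi hj
    by_contra hab
    refine hcon ⟨![a, b], ?_, Fin.forall_fin_two.2 ⟨⟨i, hi⟩, ⟨j, hj⟩⟩⟩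
    intro i j hij
    fin_cases i <;> fin_cases j <;> simp_all
  have key : ∀ i j a b, p i = Sum.inl a → p j = Sum.inl b → i = j := fun i j a b hi hj =>
    hp.1 (by rw [hi, hj, huniq i j a b hi hj])
  obtain ⟨s, hs⟩ : ∃ s : Fin 5, ∀ i, i ≠ s → ∀ a, p i ≠ Sum.inl a := by
    by_cases h : ∃ s a, p s = Sum.inl a
    · obtain ⟨s, a, hsa⟩ := h
      exact ⟨s, fun i hi b hb => hi (key _ _ _ _ hb hsa)⟩
    · push Not at h
      exact ⟨0, fun i _ => h i⟩
  have hedge : ∀ i : Fin 4, i.castSucc ≠ s → i.succ ≠ s →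
      (∃ b, p i.castSucc = Sum.inr (Sum.inl b)) ∧ ∃ b, p i.succ = Sum.inr (Sum.inl b) :=
    fun i h1 h2 => sPlus_adj_outside (hp.2 i) (hs _ h1) (hs _ h2)
  have hthree : ∀ i j l : Fin 5, i ≠ j → i ≠ l → j ≠ l → (∃ b, p i = Sum.inr (Sum.inl b)) →
      (∃ b, p j = Sum.inr (Sum.inl b)) → (∃ b, p l = Sum.inr (Sum.inl b)) → False := by
    rintro i j l hij hil hjl ⟨a, ha⟩ ⟨b, hb⟩ ⟨c, hc⟩
    have h1 : a ≠ b := fun h => hij (hp.1 (by rw [ha, hb, h]))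
    have h2 : a ≠ c := fun h => hil (hp.1 (by rw [ha, hc, h]))
    have h3 : b ≠ c := fun h => hjl (hp.1 (by rw [hb, hc, h]))
    omega
  have h012 : s ≠ 0 → s ≠ 1 → s ≠ 2 → False := fun h0 h1 h2 =>
    hthree 0 1 2 (by decide) (by decide) (by decide) (hedge 0 h0.symm h1.symm).1
      (hedge 0 h0.symm h1.symm).2 (hedge 1 h1.symm h2.symm).2
  have h234 : s ≠ 2 → s ≠ 3 → s ≠ 4 → False := fun h2 h3 h4 =>
    hthree 2 3 4 (by decide) (by decide) (by decide) (hedge 2 h2.symm h3.symm).1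
      (hedge 2 h2.symm h3.symm).2 (hedge 3 h3.symm h4.symm).2
  have h0134 : s ≠ 0 → s ≠ 1 → s ≠ 3 → s ≠ 4 → False := fun h0 h1 h3 h4 =>
    hthree 0 1 3 (by decide) (by decide) (by decide) (hedge 0 h0.symm h1.symm).1
      (hedge 0 h0.symm h1.symm).2 (hedge 3 h3.symm h4.symm).1
  clear hs hedge
  fin_cases s <;> first
    | exact h012 (by decide) (by decide) (by decide)
    | exact h234 (by decide) (by decide) (by decide)
    | exact h0134 (by decide) (by decide) (by decide) (by decide)

theorem forest_free_sPlus (n k : ℕ) : (forest k).Free (sPlus n (k + 3)) := by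
  rintro ⟨f⟩
  have hf : Function.Injective f := f.injective
  have hpath : ∀ i : Fin 2, IsP5 (sPlus n (k + 3)) fun a => f (Sum.inr (i, a)) := by
    refine fun i => ⟨fun a b hab => ?_, fun a => f.toHom.map_adj ?_⟩
    · simpa using hf hab
    · simp [forest, copies, SimpleGraph.pathGraph_adj]
  have hstar : ∀ i : Fin k, ∃ a l, f (Sum.inl (i, a)) = Sum.inl l := by
    intro i
    by_contra hcon
    push Not at hcon
    have hadj : ∀ a : Fin 5, a ≠ 0 →
        (sPlus n (k + 3)).Adj (f (Sum.inl (i, 0))) (f (Sum.inl (i, a))) := by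
      refine fun a ha => f.toHom.map_adj ?_
      simp only [forest, copies, star, SimpleGraph.sum_adj, SimpleGraph.starGraph_adj]
      simpa using ha.symm
    obtain ⟨⟨a, ha⟩, b, hb⟩ := sPlus_adj_outside (hadj 1 (by decide)) (hcon 0) (hcon 1)
    obtain ⟨-, c, hc⟩ := sPlus_adj_outside (hadj 2 (by decide)) (hcon 0) (hcon 2)
    have hne : ∀ {a b : Fin 5} {c d : Fin 2}, f (Sum.inl (i, a)) = Sum.inr (Sum.inl c) →
        f (Sum.inl (i, b)) = Sum.inr (Sum.inl d) → a ≠ b → c ≠ d := by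
      rintro a b c d h1 h2 hab rfl
      have := hf (h1.trans h2.symm)
      simp [hab] at this
    have h1 := hne ha hb (by decide)
    have h2 := hne ha hc (by decide)
    have h3 := hne hb hc (by decide)
    omega
  choose g hg hg' using fun i => exists_ne_mem_core_of_isP5 (hpath i)
  choose a l hl using hstar
  choose b hb using hg'
  let F : Fin k ⊕ (Fin 2 × Fin 2) → Fin (k + 3) := Sum.elim l fun ij => g ij.1 ij.2
  have hF : Function.Injective F := by
    rintro (i | ⟨i, j⟩) (i' | ⟨i', j'⟩) h
    · change l i = l i' at h
      have := hf ((hl i).trans (h ▸ (hl i').symm))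
      simp at this
      rw [this.1]
    · change l i = g i' j' at h
      have := hf ((hl i).trans (h ▸ (hb i' j').symm))
      simp at this
    · change g i j = l i' at h
      have := hf ((hb i j).trans (h ▸ (hl i').symm))
      simp at this
    · change g i j = g i' j' at h
      have := hf ((hb i j).trans (h ▸ (hb i' j').symm))
      simp at this
      obtain ⟨rfl, -⟩ := this
      rw [hg i h]
  have := Fintype.card_le_of_injective F hF
  simp at this

/-- `S⁺` on an arbitrary vertex set: the vertices of `L` are joined to everything, and `p`, `q` are
joined to each other. -/
def coreGraph {V : Type*} (L : Finset V) (p q : V) : SimpleGraph V where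
  Adj u w := u ≠ w ∧ (u ∈ L ∨ w ∈ L ∨ (u = p ∧ w = q) ∨ (u = q ∧ w = p))
  symm := ⟨fun _ _ h => ⟨h.1.symm, by tauto⟩⟩
  loopless := ⟨fun _ h => h.1 rfl⟩

theorem nonempty_coreGraph_iso {n h : ℕ} {L : Finset (Fin n)} (hL : L.card = h) {p q : Fin n}
    (hpq : p ≠ q) (hp : p ∉ L) (hq : q ∉ L) : Nonempty (coreGraph L p q ≃g sPlus n h) := by
  have hrest : ((L ∪ {p, q})ᶜ).card = n - h - 2 := by
    rw [Finset.card_compl, Finset.card_union_of_disjoint, Finset.card_pair hpq, hL,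
      Fintype.card_fin]
    · omega
    · simp [hp, hq]
  let eL := (L.equivFinOfCardEq hL).symm
  let eR := (((L ∪ {p, q})ᶜ).equivFinOfCardEq hrest).symm
  let F : Fin h ⊕ (Fin 2 ⊕ Fin (n - h - 2)) → Fin n :=
    Sum.elim (fun i => eL i) (Sum.elim ![p, q] fun i => eR i)
  have hLm : ∀ i, (eL i : Fin n) ∈ L := fun i => (eL i).2
  have hRm : ∀ i, (eR i : Fin n) ∉ L ∧ (eR i : Fin n) ≠ p ∧ (eR i : Fin n) ≠ q := fun i => by
    have := (eR i).2
    simp only [Finset.mem_compl, Finset.mem_union, Finset.mem_insert, Finset.mem_singleton,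
      not_or] at this
    exact this
  have hF : Function.Injective F := by
    rintro (i | i | i) (j | j | j) hij
    · rw [eL.injective (Subtype.ext hij)]
    · exfalso
      change (eL i : Fin n) = ![p, q] j at hij
      have := hLm i
      fin_cases j <;> simp_all
    · exfalso
      change (eL i : Fin n) = eR j at hij
      exact (hRm j).1 (hij ▸ hLm i)
    · exfalso
      change ![p, q] i = eL j at hij
      have := hLm j
      fin_cases i <;> simp_all
    · change ![p, q] i = ![p, q] j at hij
      fin_cases i <;> fin_cases j <;> simp_all
    · exfalso
      change ![p, q] i = eR j at hij
      have := hRm j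
      fin_cases i <;> simp_all
    · exfalso
      change (eR i : Fin n) = eL j at hij
      exact (hRm i).1 (hij ▸ hLm j)
    · exfalso
      change (eR i : Fin n) = ![p, q] j at hij
      have := hRm i
      fin_cases j <;> simp_all
    · rw [eR.injective (Subtype.ext hij)]
  have hcard : h + 2 ≤ n := by
    have := Finset.card_le_univ (L ∪ {p, q})
    rw [Finset.card_union_of_disjoint (by simp [hp, hq]), Finset.card_pair hpq, hL,
      Fintype.card_fin] at this
    exact this
  have hbij : Function.Bijective F := by
    rw [Fintype.bijective_iff_injective_and_card]
    refine ⟨hF, ?_⟩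
    simp
    omega
  refine ⟨(SimpleGraph.Iso.symm ⟨Equiv.ofBijective F hbij, fun {a b} => ?_⟩)⟩
  change (F a ≠ F b ∧ (F a ∈ L ∨ F b ∈ L ∨ (F a = p ∧ F b = q) ∨ (F a = q ∧ F b = p))) ↔ _
  rw [hF.ne_iff]
  rcases a with i | i | i <;> rcases b with j | j | j
  · simp [sPlus, join, F, hLm]
  · simp [sPlus, join, F, hLm]
  · simp [sPlus, join, F, hLm]
  · simp [sPlus, join, F, hLm]
  · fin_cases i <;> fin_cases j <;> simp [sPlus, join, F, hp, hq, hpq, hpq.symm]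
  · have := hRm j
    fin_cases i <;> simp_all [sPlus, join, F]
  · simp [sPlus, join, F, hLm]
  · have := hRm i
    fin_cases j <;> simp_all [sPlus, join, F]
  · have := hRm i
    have := hRm j
    simp_all [sPlus, join, F]

end SPlus

/-! ### Weights outside a set meeting every five-vertex path -/

section Weights

variable {V : Type*}

theorem sum_le_card_of_le_one {x : V → ℝ} (hx1 : ∀ u, x u ≤ 1) (s : Finset V) :
    ∑ u ∈ s, x u ≤ s.card := by
  simpa using Finset.sum_le_card_nsmul s x 1 fun u _ => hx1 u

/-- A Bonferroni inequality for finite sets with small pairwise intersections. -/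
theorem sum_card_le_of_card_inter_le {ι : Type*} [DecidableEq ι] [DecidableEq V] (s : Finset ι)
    (A : ι → Finset V) (m : ℕ) (h : ∀ a ∈ s, ∀ b ∈ s, a ≠ b → (A a ∩ A b).card ≤ m) :
    ∑ a ∈ s, (A a).card ≤ (s.biUnion A).card + s.card ^ 2 * m := by
  induction s using Finset.induction_on with
  | empty => simp
  | insert a s ha ih =>
    have ih := ih fun b hb c hc => h b (Finset.mem_insert_of_mem hb) c (Finset.mem_insert_of_mem hc)
    have h1 := Finset.card_union_add_card_inter (A a) (s.biUnion A)
    have h2 : (A a ∩ s.biUnion A).card ≤ s.card * m := by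
      rw [Finset.inter_biUnion]
      refine Finset.card_biUnion_le_card_mul _ _ _ fun b hb => ?_
      exact h a (Finset.mem_insert_self _ _) b (Finset.mem_insert_of_mem hb)
        fun hab => ha (hab ▸ hb)
    rw [Finset.sum_insert ha, Finset.card_insert_of_notMem ha, Finset.biUnion_insert]
    nlinarith

variable [Fintype V] [DecidableEq V]

/-- The number of neighbours of `u` outside `C`. -/
def outDeg (G : SimpleGraph V) [DecidableRel G.Adj] (C : Finset V) (u : V) : ℕ :=
  (G.neighborFinset u \ C).card

/-- The vertices outside `C` with at least four neighbours outside `C`. -/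
def centers (G : SimpleGraph V) [DecidableRel G.Adj] (C : Finset V) : Finset V :=
  Finset.univ.filter fun t => t ∉ C ∧ 4 ≤ outDeg G C t

variable {G : SimpleGraph V} [DecidableRel G.Adj] {C : Finset V}

theorem mem_centers {t : V} : t ∈ centers G C ↔ t ∉ C ∧ 4 ≤ outDeg G C t := by
  simp [centers]

theorem degree_le_outDeg_add (u : V) : G.degree u ≤ outDeg G C u + C.card := by
  have := Finset.le_card_sdiff C (G.neighborFinset u)
  rw [G.card_neighborFinset_eq_degree] at this
  unfold outDeg
  omega

/-- Two centres adjacent to `w` would be the second and fourth vertex of a path with middle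
vertex `w`. -/
theorem card_inter_centers_le_one (hP : ∀ p, IsP5 G p → ∃ i, p i ∈ C) {w : V} (hw : w ∉ C) :
    (G.neighborFinset w ∩ centers G C).card ≤ 1 := by
  rw [Finset.card_le_one]
  intro s hs t ht
  by_contra hst
  simp only [Finset.mem_inter, SimpleGraph.mem_neighborFinset, mem_centers] at hs ht
  obtain ⟨hws, hsC, hs4⟩ := hs
  obtain ⟨hwt, htC, ht4⟩ := ht
  have h1 : ({w, t} : Finset V).card ≤ 2 := Finset.card_le_two
  obtain ⟨a, ha, ha'⟩ := Finset.exists_mem_notMem_of_card_lt_card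
    (show ({w, t} : Finset V).card < (G.neighborFinset s \ C).card by unfold outDeg at hs4; omega)
  have h2 : ({w, s, a} : Finset V).card ≤ 3 := Finset.card_le_three
  obtain ⟨b, hb, hb'⟩ := Finset.exists_mem_notMem_of_card_lt_card
    (show ({w, s, a} : Finset V).card < (G.neighborFinset t \ C).card by
      unfold outDeg at ht4; omega)
  simp only [Finset.mem_sdiff, SimpleGraph.mem_neighborFinset, Finset.mem_insert,
    Finset.mem_singleton, not_or] at ha ha' hb hb'
  obtain ⟨i, hi⟩ := hP _ (isP5_of ha.1.symm hws.symm hwt hb.1 ha'.1 ha'.2 (Ne.symm hb'.2.2) hst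
    (Ne.symm hb'.2.1) (Ne.symm hb'.1))
  fin_cases i
  · exact ha.2 hi
  · exact hsC hi
  · exact hw hi
  · exact htC hi
  · exact hb.2 hi

theorem sum_outDeg_centers_le (hP : ∀ p, IsP5 G p → ∃ i, p i ∈ C) :
    ∑ t ∈ centers G C, outDeg G C t ≤ Fintype.card V := by
  have h := Finset.sum_card_bipartiteAbove_eq_sum_card_bipartiteBelow (s := centers G C)
    (t := Cᶜ) G.Adj
  have h1 : ∀ t, outDeg G C t = (Finset.bipartiteAbove G.Adj Cᶜ t).card := fun t => by
    unfold outDeg Finset.bipartiteAbove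
    congr 1
    ext w
    simp [and_comm]
  rw [Finset.sum_congr rfl fun t _ => h1 t, h]
  calc _ ≤ ∑ _w ∈ Cᶜ, 1 := Finset.sum_le_sum fun w hw => by
        refine le_trans (Finset.card_le_card ?_)
          (card_inter_centers_le_one hP (Finset.mem_compl.1 hw))
        intro t ht
        simp only [Finset.bipartiteBelow, Finset.mem_filter] at ht
        simp [ht.1, ht.2.symm]
    _ ≤ Fintype.card V := by simpa using Finset.card_le_univ _

variable {x : V → ℝ} {r : ℝ}

/-- The eigenvalue equation for the square of the adjacency matrix. -/
theorem sq_mul_eq_sum_codeg (hx : ∀ u, ∑ w ∈ G.neighborFinset u, x w = r * x u) (v : V) :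
    r ^ 2 * x v = ∑ u, (codeg G v u : ℝ) * x u := by
  have h1 : r ^ 2 * x v = ∑ w ∈ G.neighborFinset v, ∑ u ∈ G.neighborFinset w, x u := by
    rw [Finset.sum_congr rfl fun w _ => hx w, ← Finset.mul_sum, hx]
    ring
  rw [h1, Finset.sum_comm' (t' := Finset.univ)
    (s' := fun u => G.neighborFinset v ∩ G.neighborFinset u)]
  · simp [codeg]
  · intro w u
    simp [G.adj_comm]

theorem mul_le_of_notMem_centers (hx1 : ∀ u, x u ≤ 1)
    (hx : ∀ u, ∑ w ∈ G.neighborFinset u, x w = r * x u) {u : V} (hu : u ∉ C)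
    (hT : u ∉ centers G C) : r * x u ≤ C.card + 3 ∧ G.degree u ≤ C.card + 3 := by
  have h1 := degree_le_outDeg_add (G := G) (C := C) u
  have h2 : outDeg G C u < 4 := by
    by_contra h
    exact hT (mem_centers.2 ⟨hu, by omega⟩)
  have h3 : G.degree u ≤ C.card + 3 := by omega
  refine ⟨?_, h3⟩
  rw [← hx u]
  refine (sum_le_card_of_le_one hx1 _).trans ?_
  rw [G.card_neighborFinset_eq_degree]
  exact_mod_cast h3

theorem sq_mul_le_of_mem_centers (hP : ∀ p, IsP5 G p → ∃ i, p i ∈ C) (hr : 0 < r)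
    (hx1 : ∀ u, x u ≤ 1) (hx : ∀ u, ∑ w ∈ G.neighborFinset u, x w = r * x u) {t : V}
    (ht : t ∈ centers G C) :
    r ^ 2 * x t ≤ r * (C.card + 1) + outDeg G C t * (C.card + 3) := by
  obtain ⟨htC, -⟩ := mem_centers.1 ht
  have hsplit : r * x t =
      ∑ w ∈ G.neighborFinset t ∩ C, x w + ∑ w ∈ G.neighborFinset t \ C, x w := by
    rw [← hx, Finset.sum_inter_add_sum_sdiff]
  have hsplit2 := Finset.sum_inter_add_sum_sdiff (G.neighborFinset t \ C) (centers G C) x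
  have h1 : ∑ w ∈ G.neighborFinset t ∩ C, x w ≤ C.card := by
    refine (sum_le_card_of_le_one hx1 _).trans ?_
    exact_mod_cast Finset.card_le_card Finset.inter_subset_right
  have h2 : ∑ w ∈ (G.neighborFinset t \ C) ∩ centers G C, x w ≤ 1 := by
    refine (sum_le_card_of_le_one hx1 _).trans ?_
    exact_mod_cast (Finset.card_le_card (Finset.inter_subset_inter_right
      Finset.sdiff_subset)).trans (card_inter_centers_le_one hP htC)
  have h3 : r * ∑ w ∈ (G.neighborFinset t \ C) \ centers G C, x w
      ≤ outDeg G C t * (C.card + 3) := by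
    rw [Finset.mul_sum]
    refine (Finset.sum_le_card_nsmul _ _ ((C.card : ℝ) + 3) fun w hw => ?_).trans ?_
    · rw [Finset.mem_sdiff, Finset.mem_sdiff] at hw
      exact (mul_le_of_notMem_centers hx1 hx hw.1.2 hw.2).1
    · rw [nsmul_eq_mul, outDeg]
      refine mul_le_mul_of_nonneg_right ?_ (by positivity)
      exact_mod_cast Finset.card_le_card (Finset.sdiff_subset (s := G.neighborFinset t \ C))
  have h4 : r ^ 2 * x t = r * (r * x t) := by ring
  rw [h4, hsplit, ← hsplit2, mul_add, mul_add]
  have h5 := mul_le_mul_of_nonneg_left h1 hr.le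
  have h6 := mul_le_mul_of_nonneg_left h2 hr.le
  linarith

variable {q : ℝ}

theorem weight_le_of_notMem_centers (hx0 : ∀ u, 0 ≤ x u) (hx1 : ∀ u, x u ≤ 1)
    (hx : ∀ u, ∑ w ∈ G.neighborFinset u, x w = r * x u) (hq : (C.card : ℝ) + 3 ≤ q)
    (hrq : 6 * q ^ 2 ≤ r) {u : V} (hu : u ∉ C) (hT : u ∉ centers G C) :
    q * x u ≤ 1 / 6 := by
  obtain ⟨h1, -⟩ := mul_le_of_notMem_centers hx1 hx hu hT
  have h2 : 6 * q ^ 2 * x u ≤ q := (mul_le_mul_of_nonneg_right hrq (hx0 u)).trans (h1.trans hq)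
  nlinarith

/-- The contribution of a vertex outside `C` to the second-order eigenvalue equation at `v`: at
most `1/6`, plus a multiple of the outer degree for centres. -/
theorem codeg_mul_le (hP : ∀ p, IsP5 G p → ∃ i, p i ∈ C)
    (hx0 : ∀ u, 0 ≤ x u) (hx1 : ∀ u, x u ≤ 1)
    (hx : ∀ u, ∑ w ∈ G.neighborFinset u, x w = r * x u) (hq : (C.card : ℝ) + 3 ≤ q) (hq9 : 9 ≤ q)
    (hrq : 6 * q ^ 2 ≤ r) (v : V) {u : V} (hu : u ∉ C) :
    codeg G v u * x u ≤ 1 / 6 + (if u ∈ centers G C then 21 / 20 * (outDeg G C u : ℝ) else 0) ∧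
    ((codeg G v u : ℝ) ≤ 5 * q →
      codeg G v u * x u ≤
        1 / 6 + (if u ∈ centers G C then 1 / 20 * (outDeg G C u : ℝ) else 0)) := by
  have hr : 0 < r := by nlinarith
  by_cases hT : u ∈ centers G C
  · have h1 := sq_mul_le_of_mem_centers hP hr hx1 hx hT
    have hc : (codeg G v u : ℝ) ≤ outDeg G C u + C.card := by
      exact_mod_cast (codeg_le_degree_right G v u).trans (degree_le_outDeg_add u)
    have hd : (4 : ℝ) ≤ outDeg G C u := by exact_mod_cast (mem_centers.1 hT).2
    rw [if_pos hT, if_pos hT]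
    set d : ℝ := (outDeg G C u : ℝ)
    set m : ℝ := (codeg G v u : ℝ)
    have hm0 : 0 ≤ m := Nat.cast_nonneg _
    have hxu := hx0 u
    have hr486 : 486 ≤ r := by nlinarith
    have h2 : r ^ 2 * x u ≤ r * (q - 2) + d * q := by
      refine h1.trans ?_
      gcongr
      linarith
    have h3 : m ≤ d + (q - 3) := by linarith
    -- `d ≥ 4` absorbs the neighbours in `C` into the outer degree
    have h4 : (d + (q - 3)) * (q - 2) ≤ d * q ^ 2 / 4 := by
      nlinarith [mul_nonneg (sub_nonneg.2 hd) (sub_nonneg.2 hq9)]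
    have h5 : d * q ^ 2 / 4 * r ≤ d / 24 * r ^ 2 := by
      nlinarith [mul_le_mul_of_nonneg_left hrq (show 0 ≤ d * r by positivity)]
    have h6 : (q - 3) * (q - 2) ≤ d * q ^ 2 / 4 := by nlinarith
    have h7 : d * q ^ 2 ≤ d / 2916 * r ^ 2 := by
      nlinarith [mul_le_mul_of_nonneg_left (show 2916 * q ^ 2 ≤ r ^ 2 by nlinarith)
        (show 0 ≤ d by linarith)]
    have hr2 : 0 < r ^ 2 := by positivity
    constructor
    · have h8 : r ^ 2 * ((q - 3) * x u) ≤ r ^ 2 * (d / 20) := by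
        have := mul_le_mul_of_nonneg_left h2 (show 0 ≤ q - 3 by linarith)
        have e1 := mul_le_mul_of_nonneg_right h6 hr.le
        have e2 : (q - 3) * (d * q) ≤ d * q ^ 2 := by nlinarith
        nlinarith
      have h9 := le_of_mul_le_mul_left h8 hr2
      have h10 : m * x u ≤ (d + (q - 3)) * x u := mul_le_mul_of_nonneg_right h3 hxu
      have h11 : d * x u ≤ d := mul_le_of_le_one_right (by linarith) (hx1 u)
      linarith
    · intro hm
      have h8 : r ^ 2 * (m * x u) ≤ r ^ 2 * (d / 20) := by
        have := mul_le_mul_of_nonneg_left h2 hm0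
        have e1 : m * (r * (q - 2)) ≤ (d + (q - 3)) * (r * (q - 2)) :=
          mul_le_mul_of_nonneg_right h3 (mul_nonneg hr.le (by linarith))
        have e2 : m * (d * q) ≤ 5 * q * (d * q) := mul_le_mul_of_nonneg_right hm (by nlinarith)
        have e3 := mul_le_mul_of_nonneg_right h4 hr.le
        nlinarith
      have h9 := le_of_mul_le_mul_left h8 hr2
      linarith
  · obtain ⟨-, h2⟩ := mul_le_of_notMem_centers hx1 hx hu hT
    have h3 := weight_le_of_notMem_centers hx0 hx1 hx hq hrq hu hT
    have h4 : (codeg G v u : ℝ) ≤ q := by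
      refine le_trans ?_ hq
      exact_mod_cast (codeg_le_degree_right G v u).trans h2
    have h5 := mul_le_mul_of_nonneg_right h4 (hx0 u)
    rw [if_neg hT, if_neg hT]
    constructor
    · linarith
    · intro
      linarith

theorem sum_add_outDeg_le (hP : ∀ p, IsP5 G p → ∃ i, p i ∈ C) (s : Finset V) {a : ℝ}
    (ha : 0 ≤ a) :
    ∑ u ∈ s, (1 / 6 + (if u ∈ centers G C then a * (outDeg G C u : ℝ) else 0)) ≤
      (1 / 6 + a) * Fintype.card V := by
  refine (Finset.sum_le_univ_sum_of_nonneg fun u => by positivity).trans ?_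
  have h := sum_outDeg_centers_le hP
  have h' : (∑ t ∈ centers G C, (outDeg G C t : ℝ)) ≤ Fintype.card V := by exact_mod_cast h
  rw [Finset.sum_add_distrib, ← Finset.sum_filter, ← Finset.mul_sum]
  simp only [Finset.filter_mem_eq_inter, Finset.univ_inter, Finset.sum_const, Finset.card_univ,
    nsmul_eq_mul]
  have := mul_le_mul_of_nonneg_left h' ha
  linarith

end Weights

/-! ### The core of a forest-free graph with large spectral radius -/

section Core

variable {V : Type*} [Fintype V] [DecidableEq V] {G : SimpleGraph V} [DecidableRel G.Adj]
variable {k : ℕ} {x : V → ℝ} {r q : ℝ}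

theorem codeg_mul_le_card (hx0 : ∀ u, 0 ≤ x u) (hx1 : ∀ u, x u ≤ 1) (u v : V) :
    codeg G v u * x u ≤ Fintype.card V := by
  have h : (codeg G v u : ℝ) ≤ Fintype.card V := by exact_mod_cast Finset.card_le_univ _
  exact (mul_le_mul h (hx1 u) (hx0 u) (Nat.cast_nonneg _)).trans_eq (mul_one _)

theorem sum_codeg_mul_le_card (hx0 : ∀ u, 0 ≤ x u) (hx1 : ∀ u, x u ≤ 1) (v : V) (s : Finset V) :
    ∑ u ∈ s, (codeg G v u : ℝ) * x u ≤ s.card * Fintype.card V := by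
  refine (Finset.sum_le_card_nsmul _ _ (Fintype.card V : ℝ) fun u _ => ?_).trans ?_
  · exact codeg_mul_le_card hx0 hx1 u v
  · rw [nsmul_eq_mul]

/-- With fewer than `k` vertices of large degree, the spectral radius would be too small. -/
theorem le_card_large_degree (hx0 : ∀ u, 0 ≤ x u) (hx1 : ∀ u, x u ≤ 1) {v : V} (hv : x v = 1)
    (hx : ∀ u, ∑ w ∈ G.neighborFinset u, x w = r * x u) (hk : 1 ≤ k) (hq : q = k + 8)
    (hn : 9 * q ^ 4 + q ≤ Fintype.card V) (hr2 : 2 * q ^ 3 ≤ 3 * r)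
    (hr3 : ((k : ℝ) + 3) * (Fintype.card V - (k + 3)) ≤ r ^ 2) :
    k ≤ (Finset.univ.filter fun u => 5 * k + 15 ≤ G.degree u).card := by
  by_contra hcon
  set B := Finset.univ.filter fun u => 5 * k + 15 ≤ G.degree u with hB
  have hB1 : (B.card : ℝ) ≤ k - 1 := by
    have : B.card + 1 ≤ k := by omega
    have : (B.card : ℝ) + 1 ≤ k := by exact_mod_cast this
    linarith
  have hk1 : (1 : ℝ) ≤ k := by exact_mod_cast hk
  set n : ℝ := (Fintype.card V : ℝ) with hndef
  have hn0 : 0 ≤ n := Nat.cast_nonneg _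
  have hr0 : 0 < r := by nlinarith [show 0 < q ^ 3 by subst hq; positivity]
  have hsum := sq_mul_eq_sum_codeg hx v
  rw [hv, mul_one, ← Finset.sum_add_sum_compl B] at hsum
  have h1 := sum_codeg_mul_le_card (G := G) hx0 hx1 v B
  have h2 : ∑ u ∈ Bᶜ, (codeg G v u : ℝ) * x u ≤ 3 * n := by
    -- the degree bounds both factors, the weight after division by `r`
    have h : ∀ u ∈ Bᶜ, (codeg G v u : ℝ) * x u ≤ 3 := by
      intro u hu
      have hd : G.degree u ≤ 5 * k + 15 := by
        simp only [hB, Finset.mem_compl, Finset.mem_filter, Finset.mem_univ, true_and] at hu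
        omega
      have hd' : (G.degree u : ℝ) ≤ 5 * k + 15 := by exact_mod_cast hd
      have hc : (codeg G v u : ℝ) ≤ 5 * k + 15 := by
        exact_mod_cast (codeg_le_degree_right G v u).trans hd
      have hxu : r * x u ≤ 5 * k + 15 := by
        rw [← hx u]
        refine (sum_le_card_of_le_one hx1 _).trans ?_
        rwa [G.card_neighborFinset_eq_degree]
      have h3 : r * (codeg G v u * x u) ≤ r * 3 := by
        have e1 : (codeg G v u : ℝ) * (r * x u) ≤ (5 * k + 15) * (5 * k + 15) :=
          mul_le_mul hc hxu (mul_nonneg hr0.le (hx0 u)) (by positivity)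
        have e2 : ((5 : ℝ) * k + 15) * (5 * k + 15) ≤ 2 * q ^ 3 := by
          subst hq
          nlinarith [mul_nonneg (show (0:ℝ) ≤ k by linarith) (mul_self_nonneg ((k : ℝ))),
            sq_nonneg ((k : ℝ))]
        nlinarith
      exact le_of_mul_le_mul_left h3 hr0
    refine (Finset.sum_le_card_nsmul _ _ _ h).trans ?_
    rw [nsmul_eq_mul, mul_comm]
    gcongr
    rw [hndef]
    exact_mod_cast Finset.card_le_univ _
  have h4 : (B.card : ℝ) * n ≤ (k - 1) * n := mul_le_mul_of_nonneg_right hB1 hn0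
  have h5 : ((k : ℝ) + 3) * (k + 3) < n := by
    subst hq
    nlinarith [mul_nonneg (show (0:ℝ) ≤ k by linarith) (mul_self_nonneg ((k : ℝ))),
            sq_nonneg ((k : ℝ)), sq_nonneg ((k : ℝ) ^ 2)]
  nlinarith

/-- A forest-free graph with `k` vertices of large degree has a set of at most `k + 5` vertices
meeting all paths on five vertices: those `k` vertices, and the vertices of one path avoiding
them. -/
theorem exists_hitting_set (hfree : (forest k).Free G)
    (hk : k ≤ (Finset.univ.filter fun u => 5 * k + 15 ≤ G.degree u).card) :
    ∃ C : Finset V, C.card ≤ k + 5 ∧ ∀ p, IsP5 G p → ∃ i, p i ∈ C := by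
  obtain ⟨C, hC, hcard⟩ := Finset.exists_subset_card_eq hk
  have hdeg : ∀ c ∈ C, 5 * k + 10 ≤ G.degree c := fun c hc => by
    have := (Finset.mem_filter.1 (hC hc)).2
    omega
  by_cases h : ∃ p, IsP5 G p ∧ ∀ i, p i ∉ C
  · obtain ⟨p, hp, hpC⟩ := h
    refine ⟨C ∪ Finset.univ.image p, ?_, fun p' hp' => ?_⟩
    · refine (Finset.card_union_le _ _).trans ?_
      have : (Finset.univ.image p).card ≤ 5 := Finset.card_image_le.trans (by simp)
      omega
    · by_contra hcon
      simp only [Finset.mem_union, Finset.mem_image, Finset.mem_univ, true_and, not_exists,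
        not_or] at hcon
      exact hfree (isContained_of_paths (p := ![p, p']) (Fin.forall_fin_two.2 ⟨hp, hp'⟩)
        (fun i j => (hcon j).2 i) hcard.ge (Fin.forall_fin_two.2 ⟨hpC, fun j => (hcon j).1⟩) hdeg)
  · push Not at h
    exact ⟨C, by omega, h⟩

/-- If `k + 3` vertices each share many neighbours with `v`, then any two of them share few. -/
theorem codeg_lt_of_free (hfree : (forest k).Free G) {v : V} {B : Finset V} (hB : k + 3 ≤ B.card)
    (hvB : v ∉ B) (hcodeg : ∀ u ∈ B, 5 * k + 15 ≤ codeg G v u) {a b : V} (ha : a ∈ B)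
    (hb : b ∈ B) (hab : a ≠ b) : codeg G a b < 5 * k + 15 := by
  by_contra hcon
  obtain ⟨D, hD, hDcard⟩ := Finset.exists_subset_card_eq
    (show k + 1 ≤ ((B.erase a).erase b).card by
      rw [Finset.card_erase_of_mem (Finset.mem_erase.2 ⟨hab.symm, hb⟩), Finset.card_erase_of_mem ha]
      omega)
  obtain ⟨c, hc⟩ := Finset.card_pos.1 (show 0 < D.card by omega)
  have hDB : ∀ u ∈ D, u ∈ B ∧ u ≠ a ∧ u ≠ b := fun u hu => by
    have := hD hu
    simp only [Finset.mem_erase] at this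
    exact ⟨this.2.2, this.2.1, this.1⟩
  have hE : (D.erase c).card = k := by rw [Finset.card_erase_of_mem hc]; omega
  have hA : (insert a (insert b (D.erase c))).card ≤ k + 2 := by
    have h1 := Finset.card_insert_le a (insert b (D.erase c))
    have h2 := Finset.card_insert_le b (D.erase c)
    omega
  have hne : ∀ u ∈ B, v ≠ u := fun u hu h => hvB (h ▸ hu)
  obtain ⟨p, hp, hpA⟩ := exists_isP5_of_codeg G (u := v) (v := c)
    (A := insert a (insert b (D.erase c))) (hne c (hDB c hc).1)
    (by have := hcodeg c (hDB c hc).1; omega)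
    (by
      simp only [Finset.mem_insert, Finset.mem_erase, not_or, not_and]
      exact ⟨hne a ha, hne b hb, fun _ h => hne v (hDB v h).1 rfl⟩)
    (by
      simp only [Finset.mem_insert, Finset.mem_erase, not_or, not_and]
      exact ⟨(hDB c hc).2.1, (hDB c hc).2.2, fun h => absurd rfl h⟩)
  simp only [Finset.mem_insert, not_or] at hpA
  refine hfree (isContained_of_isP5_of_codeg hp hab (not_lt.1 hcon) hE.ge (fun u hu => ?_)
    (fun i => (hpA i).2.2) (fun i => (hpA i).1) (fun i => (hpA i).2.1) ?_ ?_)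
  · exact (hcodeg u (hDB u (Finset.mem_of_mem_erase hu)).1).trans (codeg_le_degree_right G v u)
  · exact fun h => (hDB a (Finset.mem_of_mem_erase h)).2.1 rfl
  · exact fun h => (hDB b (Finset.mem_of_mem_erase h)).2.2 rfl

/-- The second-order eigenvalue equation at a vertex `v` of maximum weight forces `k + 3` vertices
of weight close to `1` that are jointly adjacent to almost all vertices. -/
theorem exists_core (hfree : (forest k).Free G)
    (hx0 : ∀ u, 0 ≤ x u) (hx1 : ∀ u, x u ≤ 1) {v : V} (hv : x v = 1)
    (hx : ∀ u, ∑ w ∈ G.neighborFinset u, x w = r * x u) (hk : 1 ≤ k) (hq : q = k + 8)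
    (hn : 9 * q ^ 4 + q ≤ Fintype.card V) (hr1 : 6 * q ^ 2 ≤ r) (hr2 : 2 * q ^ 3 ≤ 3 * r)
    (hr3 : ((k : ℝ) + 3) * (Fintype.card V - (k + 3)) ≤ r ^ 2) :
    ∃ L : Finset V, L.card = k + 3 ∧ (∀ l ∈ L, 3 / 4 ≤ x l) ∧
      4 * (Finset.univ.filter fun w => ∃ l ∈ L, ¬ G.Adj l w).card ≤ Fintype.card V := by
  obtain ⟨C, hC, hP⟩ := exists_hitting_set hfree
    (le_card_large_degree hx0 hx1 hv hx hk hq hn hr2 hr3)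
  have hk1 : (1 : ℝ) ≤ k := by exact_mod_cast hk
  have hq9 : 9 ≤ q := by linarith
  have hCq : (C.card : ℝ) + 3 ≤ q := by
    have : (C.card : ℝ) ≤ k + 5 := by exact_mod_cast hC
    linarith
  set n : ℝ := (Fintype.card V : ℝ) with hndef
  have hn0 : 0 ≤ n := Nat.cast_nonneg _
  have hnq2 : 729 * q ^ 2 ≤ n := by
    nlinarith [mul_le_mul_of_nonneg_left (show 81 ≤ q ^ 2 by nlinarith) (sq_nonneg q)]
  have hnq3 : 81 * q ^ 3 ≤ n := by nlinarith [pow_pos (show 0 < q by linarith) 3]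
  have hhq : ((k : ℝ) + 3) * (k + 3) ≤ q ^ 2 := by subst hq; nlinarith
  have hsum := sq_mul_eq_sum_codeg hx v
  rw [hv, mul_one] at hsum
  let f : V → ℝ := fun u => (codeg G v u : ℝ) * x u
  change r ^ 2 = ∑ u, f u at hsum
  have hf0 : ∀ u, 0 ≤ f u := fun u => mul_nonneg (Nat.cast_nonneg _) (hx0 u)
  have hfn : ∀ u, f u ≤ n := fun u => codeg_mul_le_card hx0 hx1 u v
  set B := Finset.univ.filter fun u => u ≠ v ∧ 5 * k + 15 ≤ codeg G v u with hB
  have hvB : v ∉ B := by simp [hB]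
  have hBc : ∀ u ∈ B, 5 * k + 15 ≤ codeg G v u := fun u hu => (Finset.mem_filter.1 hu).2.2
  have hsmall : ∀ u, u ∉ insert v B → (codeg G v u : ℝ) ≤ 5 * q := by
    intro u hu
    simp only [hB, Finset.mem_insert, Finset.mem_filter, Finset.mem_univ, true_and, not_or,
      not_and, not_le] at hu
    have h1 : codeg G v u ≤ 5 * k + 15 := (hu.2 hu.1).le
    have h2 : (codeg G v u : ℝ) ≤ 5 * k + 15 := by exact_mod_cast h1
    linarith
  have hsmallC : ∀ s : Finset V, s ⊆ C → (∀ u ∈ s, u ∉ insert v B) → ∑ u ∈ s, f u ≤ 5 * q ^ 2 := by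
    intro s hs hsB
    have hcard : (s.card : ℝ) ≤ q := by
      have : (s.card : ℝ) ≤ C.card := by exact_mod_cast Finset.card_le_card hs
      linarith
    refine (Finset.sum_le_card_nsmul _ _ (5 * q) fun u hu => ?_).trans ?_
    · exact (mul_le_of_le_one_right (Nat.cast_nonneg _) (hx1 u)).trans (hsmall u (hsB u hu))
    · rw [nsmul_eq_mul]
      nlinarith
  -- everything but `v` and `B` contributes little
  have hmain : r ^ 2 ≤ ∑ u ∈ insert v B, f u + (13 / 60 * n + 5 * q ^ 2) := by
    rw [hsum, ← Finset.sum_add_sum_compl (insert v B),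
      ← Finset.sum_inter_add_sum_sdiff (insert v B)ᶜ C]
    have h1 := hsmallC ((insert v B)ᶜ ∩ C) Finset.inter_subset_right
      fun u hu => Finset.mem_compl.1 (Finset.mem_inter.1 hu).1
    have h2 : ∑ u ∈ (insert v B)ᶜ \ C, f u ≤ (1 / 6 + 1 / 20) * n := by
      refine le_trans (Finset.sum_le_sum fun u hu => ?_)
        (sum_add_outDeg_le hP ((insert v B)ᶜ \ C) (by norm_num))
      obtain ⟨hu1, hu2⟩ := Finset.mem_sdiff.1 hu
      exact (codeg_mul_le hP hx0 hx1 hx hCq hq9 hr1 v hu2).2 (hsmall u (Finset.mem_compl.1 hu1))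
    linarith
  have hlow : ((k : ℝ) + 3 - 1 / 4) * n ≤ ∑ u ∈ insert v B, f u := by nlinarith
  -- fewer than `k + 2` vertices cannot carry the sum
  have hge : k + 2 ≤ B.card := by
    by_contra hcon
    have h1 : ∑ u ∈ insert v B, f u ≤ (insert v B).card * n := sum_codeg_mul_le_card hx0 hx1 v _
    rw [Finset.card_insert_of_notMem hvB] at h1
    have h2 : B.card + 1 ≤ k + 2 := by omega
    have h3 : ((B.card + 1 : ℕ) : ℝ) ≤ k + 2 := by exact_mod_cast h2
    nlinarith
  -- with more of them, their neighbourhoods inside that of `v` are almost disjoint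
  have hle : B.card ≤ k + 2 := by
    by_contra hcon
    have hpair : ∀ a ∈ C ∩ B, ∀ b ∈ C ∩ B, a ≠ b →
        (G.neighborFinset a ∩ G.neighborFinset b).card ≤ 5 * k + 15 := fun a ha b hb hab =>
      (codeg_lt_of_free hfree (by omega) hvB hBc (Finset.mem_inter.1 ha).2
        (Finset.mem_inter.1 hb).2 hab).le
    have hbon := sum_card_le_of_card_inter_le (C ∩ B)
      (fun u => G.neighborFinset v ∩ G.neighborFinset u) (5 * k + 15) fun a ha b hb hab =>
        (Finset.card_le_card (Finset.inter_subset_inter Finset.inter_subset_right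
          Finset.inter_subset_right)).trans (hpair a ha b hb hab)
    have h1 : ∑ u ∈ C ∩ B, f u ≤ n + 5 * q ^ 3 := by
      have e1 : ∑ u ∈ C ∩ B, f u ≤ ∑ u ∈ C ∩ B, (codeg G v u : ℝ) := Finset.sum_le_sum fun u _ =>
        mul_le_of_le_one_right (Nat.cast_nonneg _) (hx1 u)
      have e2 : (∑ u ∈ C ∩ B, codeg G v u) ≤ Fintype.card V + (C ∩ B).card ^ 2 * (5 * k + 15) :=
        hbon.trans (Nat.add_le_add_right (Finset.card_le_univ _) _)
      have e3 : (∑ u ∈ C ∩ B, (codeg G v u : ℝ)) ≤ n + ((C ∩ B).card : ℝ) ^ 2 * (5 * k + 15) := by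
        rw [hndef]
        exact_mod_cast e2
      have e4 : ((C ∩ B).card : ℝ) ≤ q := by
        have : ((C ∩ B).card : ℝ) ≤ C.card := by
          exact_mod_cast Finset.card_le_card Finset.inter_subset_left
        linarith
      have e5 : ((C ∩ B).card : ℝ) ^ 2 * (5 * k + 15) ≤ q ^ 2 * (5 * q) := by
        gcongr
        linarith
      linarith [show q ^ 2 * (5 * q) = 5 * q ^ 3 by ring]
    have h2 : ∑ u ∈ (C \ B).erase v, f u ≤ 5 * q ^ 2 := by
      refine hsmallC _ (fun u hu => ?_) fun u hu => ?_ <;>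
        simp only [Finset.mem_erase, Finset.mem_sdiff] at hu
      · exact hu.2.1
      · simp [hu.1, hu.2.2]
    have h3 : ∑ u ∈ C \ B, f u ≤ n + 5 * q ^ 2 := by
      by_cases hvC : v ∈ C \ B
      · rw [← Finset.add_sum_erase _ _ hvC]
        linarith [hfn v]
      · rw [Finset.erase_eq_of_notMem hvC] at h2
        linarith
    have h4 : ∑ u ∈ Cᶜ, f u ≤ (1 / 6 + 21 / 20) * n := by
      refine le_trans (Finset.sum_le_sum fun u hu => ?_) (sum_add_outDeg_le hP Cᶜ (by norm_num))
      exact (codeg_mul_le hP hx0 hx1 hx hCq hq9 hr1 v (Finset.mem_compl.1 hu)).1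
    have h5 : r ^ 2 ≤ (n + 5 * q ^ 3) + (n + 5 * q ^ 2) + (1 / 6 + 21 / 20) * n := by
      rw [hsum, ← Finset.sum_add_sum_compl C, ← Finset.sum_inter_add_sum_sdiff C B]
      linarith
    nlinarith
  have hcard : (insert v B).card = k + 3 := by
    rw [Finset.card_insert_of_notMem hvB]
    omega
  have hdef : ∑ u ∈ insert v B, (n - f u) ≤ n / 4 := by
    rw [Finset.sum_sub_distrib, Finset.sum_const, hcard, nsmul_eq_mul]
    push_cast
    linarith
  refine ⟨insert v B, hcard, fun l hl => ?_, ?_⟩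
  · have h1 := (Finset.single_le_sum (f := fun u => n - f u)
      (fun u _ => sub_nonneg.2 (hfn u)) hl).trans hdef
    have h2 : f l ≤ n * x l := by
      refine mul_le_mul_of_nonneg_right ?_ (hx0 l)
      rw [hndef]
      exact_mod_cast Finset.card_le_univ _
    have h3 : n * (3 / 4) ≤ n * x l := by
      linarith
    exact le_of_mul_le_mul_left h3 (by nlinarith)
  · have hsub : (Finset.univ.filter fun w => ∃ l ∈ insert v B, ¬ G.Adj l w) ⊆
        (insert v B).biUnion fun u => (G.neighborFinset v ∩ G.neighborFinset u)ᶜ := by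
      intro w hw
      obtain ⟨l, hl, hlw⟩ := (Finset.mem_filter.1 hw).2
      refine Finset.mem_biUnion.2 ⟨l, hl, ?_⟩
      simp [hlw]
    have h1 := (Finset.card_le_card hsub).trans Finset.card_biUnion_le
    have h2 : ((∑ u ∈ insert v B, ((G.neighborFinset v ∩ G.neighborFinset u)ᶜ).card : ℕ) : ℝ)
        ≤ n / 4 := by
      push_cast
      refine le_trans (Finset.sum_le_sum fun u _ => ?_) hdef
      rw [Finset.card_compl, Nat.cast_sub (Finset.card_le_univ _)]
      exact sub_le_sub_left (mul_le_of_le_one_right (Nat.cast_nonneg _) (hx1 u)) _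
    have h3 : ((Finset.univ.filter fun w => ∃ l ∈ insert v B, ¬ G.Adj l w).card : ℝ) ≤ n / 4 :=
      le_trans (by exact_mod_cast h1) h2
    have h4 : (4 : ℝ) * ((Finset.univ.filter fun w => ∃ l ∈ insert v B, ¬ G.Adj l w).card : ℝ)
        ≤ Fintype.card V := by linarith
    exact_mod_cast h4

end Core

/-! ### Comparison with `S⁺` -/

section Comparison

/-- If the adjacency relation of `S` contains that of `G` and the quadratic forms agree at a
positive vector, then `G = S`. -/
theorem eq_of_quadForm_le {V : Type*} [Fintype V] {G S : SimpleGraph V} [DecidableRel G.Adj]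
    [DecidableRel S.Adj] {x : V → ℝ} (hGS : G ≤ S)
    (hx : ∀ u, 0 < x u) (h : quadForm S x ≤ quadForm G x) : G = S := by
  refine le_antisymm hGS fun u w huw => ?_
  by_contra hG
  refine absurd h (not_le.2 ?_)
  have hle : ∀ u w, (if G.Adj u w then x u * x w else 0) ≤ if S.Adj u w then x u * x w else 0 := by
    intro u w
    have := mul_pos (hx u) (hx w)
    split_ifs with h1 h2
    · exact le_rfl
    · exact absurd (hGS h1) h2
    · exact this.le
    · exact le_rfl
  refine Finset.sum_lt_sum (fun u _ => Finset.sum_le_sum fun w _ => hle u w)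
    ⟨u, Finset.mem_univ _, Finset.sum_lt_sum (fun w _ => hle u w) ⟨w, Finset.mem_univ _, ?_⟩⟩
  rw [if_neg hG, if_pos huw]
  exact mul_pos (hx u) (hx w)

variable {V : Type*} [Fintype V] [DecidableEq V] {G : SimpleGraph V} [DecidableRel G.Adj]
variable {k : ℕ} {x : V → ℝ} {r q : ℝ} {L : Finset V}

theorem le_codeg_of_core (hL : 4 * (Finset.univ.filter fun w => ∃ l ∈ L, ¬ G.Adj l w).card ≤
    Fintype.card V) {u v : V} (hu : u ∈ L) (hv : v ∈ L) :
    3 * Fintype.card V ≤ 4 * codeg G u v := by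
  have h : (Finset.univ.filter fun w => ∃ l ∈ L, ¬ G.Adj l w)ᶜ ⊆
      G.neighborFinset u ∩ G.neighborFinset v := by
    intro w hw
    simp only [Finset.mem_compl, Finset.mem_filter, Finset.mem_univ, true_and, not_exists,
      not_and, not_not] at hw
    simp [hw u hu, hw v hv]
  have h1 := Finset.card_le_card h
  rw [Finset.card_compl] at h1
  unfold codeg
  omega

/-- No path with three vertices outside the core starts at a vertex joined to the whole core: the
core would extend it to a path on five vertices meeting the core once. -/
theorem false_of_path_outside (hfree : (forest k).Free G) (hLcard : L.card = k + 3)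
    (hcodeg : ∀ u ∈ L, ∀ v ∈ L, 5 * k + 15 ≤ codeg G u v) {s a b : V} (hs : s ∉ L)
    (hsL : ∀ l ∈ L, G.Adj l s) (ha : a ∉ L) (hb : b ∉ L) (hsa : G.Adj s a) (hab : G.Adj a b)
    (hsb : s ≠ b) : False := by
  obtain ⟨l, hl⟩ := Finset.card_pos.1 (show 0 < L.card by omega)
  have hdeg := hcodeg l hl l hl
  rw [codeg_self] at hdeg
  have hA : (insert s (insert a (insert b L))).card ≤ k + 6 := by grind
  obtain ⟨c, hlc, hc⟩ := exists_adj_notMem G (u := l) (A := insert s (insert a (insert b L)))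
    (by omega)
  simp only [Finset.mem_insert, not_or] at hc
  have hne : ∀ {w}, w ∉ L → l ≠ w := fun hw h => hw (h ▸ hl)
  refine hfree (isContained_of_common hLcard hcodeg (isP5_of hlc.symm (hsL l hl) hsa hab hc.1
    hc.2.1 hc.2.2.1 (hne ha) (hne hb) hsb) l fun i hi => ?_)
  fin_cases i
  · exact absurd hi hc.2.2.2
  · rfl
  · exact absurd hi hs
  · exact absurd hi ha
  · exact absurd hi hb

/-- Two disjoint edges outside the core, each with an end joined to the whole core, form a path on
five vertices together with one vertex of the core. -/
theorem false_of_disjoint_edges (hfree : (forest k).Free G) (hLcard : L.card = k + 3)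
    (hcodeg : ∀ u ∈ L, ∀ v ∈ L, 5 * k + 15 ≤ codeg G u v) {s a t b : V} (hs : s ∉ L)
    (hsL : ∀ l ∈ L, G.Adj l s) (ht : t ∉ L) (htL : ∀ l ∈ L, G.Adj l t) (ha : a ∉ L) (hb : b ∉ L)
    (hsa : G.Adj s a) (htb : G.Adj t b) (hst : s ≠ t) (hsb : s ≠ b) (hat : a ≠ t) (hab : a ≠ b) :
    False := by
  obtain ⟨l, hl⟩ := Finset.card_pos.1 (show 0 < L.card by omega)
  have hne : ∀ {w}, w ∉ L → l ≠ w := fun hw h => hw (h ▸ hl)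
  refine hfree (isContained_of_common hLcard hcodeg (isP5_of hsa.symm (hsL l hl).symm (htL l hl)
    htb (hne ha).symm hat hab hst hsb (hne hb)) l fun i hi => ?_)
  fin_cases i
  · exact absurd hi ha
  · exact absurd hi hs
  · rfl
  · exact absurd hi ht
  · exact absurd hi hb

/-- Among the vertices joined to the whole core there is at most one edge. -/
theorem exists_pair_of_full (hfree : (forest k).Free G) (hLcard : L.card = k + 3)
    (hcodeg : ∀ u ∈ L, ∀ v ∈ L, 5 * k + 15 ≤ codeg G u v) (hn : k + 5 ≤ Fintype.card V) :
    ∃ p q, p ≠ q ∧ p ∉ L ∧ q ∉ L ∧ ∀ u w, u ∉ L → w ∉ L → (∀ l ∈ L, G.Adj l u) →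
      (∀ l ∈ L, G.Adj l w) → G.Adj u w → (u = p ∧ w = q) ∨ (u = q ∧ w = p) := by
  by_cases h : ∃ p q, p ∉ L ∧ q ∉ L ∧ (∀ l ∈ L, G.Adj l p) ∧ (∀ l ∈ L, G.Adj l q) ∧ G.Adj p q
  · obtain ⟨p, q, hp, hq, hpL, hqL, hpq⟩ := h
    refine ⟨p, q, hpq.ne, hp, hq, fun u w hu hw huL hwL huw => ?_⟩
    have hpath : ∀ {s a b : V}, s ∉ L → (∀ l ∈ L, G.Adj l s) → a ∉ L → b ∉ L → G.Adj s a →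
        G.Adj a b → s = b := fun hs hsL ha hb hsa hab => by
      by_contra hsb
      exact false_of_path_outside hfree hLcard hcodeg hs hsL ha hb hsa hab hsb
    by_cases h1 : u = p
    · subst h1
      exact Or.inl ⟨rfl, hpath hw hwL hu hq huw.symm hpq⟩
    by_cases h2 : u = q
    · subst h2
      exact Or.inr ⟨rfl, hpath hw hwL hu hp huw.symm hpq.symm⟩
    by_cases h3 : w = p
    · subst h3
      exact absurd (hpath hu huL hw hq huw hpq) h2
    by_cases h4 : w = q
    · subst h4
      exact absurd (hpath hu huL hw hp huw hpq.symm) h1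
    exact (false_of_disjoint_edges hfree hLcard hcodeg hu huL hp hpL hw hq huw hpq h1 h2 h3
      h4).elim
  · have hc : 2 ≤ Lᶜ.card := by rw [Finset.card_compl]; omega
    obtain ⟨p, hp, q, hq, hpq⟩ := Finset.one_lt_card.1 hc
    refine ⟨p, q, hpq, Finset.mem_compl.1 hp, Finset.mem_compl.1 hq,
      fun u w hu hw huL hwL huw => ?_⟩
    exact (h ⟨u, w, hu, hw, huL, hwL, huw⟩).elim

/-- A nonnegative eigenvector of a graph with a dominating vertex is positive. -/
theorem pos_of_dominating {S : SimpleGraph V} [DecidableRel S.Adj] {ρ : ℝ}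
    (hx0 : ∀ u, 0 ≤ x u) {v : V} (hv : 0 < x v) {l : V} (hl : ∀ u, u ≠ l → S.Adj l u) (hρ : 0 < ρ)
    (hx : ∀ u, ∑ w ∈ S.neighborFinset u, x w = ρ * x u) (u : V) : 0 < x u := by
  have key : ∀ {a b}, S.Adj a b → 0 < x b → 0 < x a := fun {a b} hab hb => by
    have h : x b ≤ ∑ w ∈ S.neighborFinset a, x w :=
      Finset.single_le_sum (fun w _ => hx0 w) (by simpa using hab)
    rw [hx] at h
    exact pos_of_mul_pos_right (hb.trans_le h) hρ.le
  have hxl : 0 < x l := by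
    by_cases h : v = l
    · exact h ▸ hv
    · exact key (hl v h) hv
  by_cases h : u = l
  · exact h ▸ hxl
  · exact key (hl u h).symm hxl

/-- A centre outside the core with at most `n / 4` outer neighbours has moderate weight. The outer
neighbours of a centre all miss some vertex of the core, so the bound does apply to all centres. -/
theorem weight_le_of_mem_centers (hP : ∀ p, IsP5 G p → ∃ i, p i ∈ L) (hLcard : L.card = k + 3)
    (hx1 : ∀ u, x u ≤ 1)
    (hx : ∀ u, ∑ w ∈ G.neighborFinset u, x w = r * x u) (hk : 1 ≤ k) (hq : q = k + 8)
    (hn : 9 * q ^ 4 + q ≤ Fintype.card V) (hr1 : 6 * q ^ 2 ≤ r)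
    (hr3 : ((k : ℝ) + 3) * (Fintype.card V - (k + 3)) ≤ r ^ 2) {t : V} (ht : t ∈ centers G L)
    (hd : 4 * outDeg G L t ≤ Fintype.card V) : x t ≤ 3 / 5 := by
  have hk1 : (1 : ℝ) ≤ k := by exact_mod_cast hk
  have hq9 : 9 ≤ q := by linarith
  have hr0 : 0 < r := by nlinarith
  have h1 := sq_mul_le_of_mem_centers hP hr0 hx1 hx ht
  have h2 : (4 : ℝ) * outDeg G L t ≤ Fintype.card V := by exact_mod_cast hd
  have h3 : (L.card : ℝ) = k + 3 := by rw [hLcard]; push_cast; ring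
  rw [h3] at h1
  set n : ℝ := (Fintype.card V : ℝ)
  have hn2 : 729 * q ^ 2 ≤ n := by
    nlinarith [mul_le_mul_of_nonneg_left (show 81 ≤ q ^ 2 by nlinarith) (sq_nonneg q)]
  have h4 : r * ((k : ℝ) + 3 + 1) ≤ r ^ 2 / 54 := by
    have e : 54 * ((k : ℝ) + 3 + 1) ≤ r := by nlinarith
    nlinarith [mul_le_mul_of_nonneg_left e hr0.le]
  have h5 : (outDeg G L t : ℝ) * (k + 3 + 3) ≤ n / 4 * (k + 6) := by
    have : (outDeg G L t : ℝ) ≤ n / 4 := by linarith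
    nlinarith
  have h6 : n / 4 * ((k : ℝ) + 6) ≤ 29 / 50 * r ^ 2 := by
    have e1 : ((k : ℝ) + 6) / 4 ≤ 7 / 16 * (k + 3) := by linarith
    have e2 := mul_le_mul_of_nonneg_right e1 (show 0 ≤ n by nlinarith)
    have e3 : ((k : ℝ) + 3) ≤ n / 100 := by subst hq; nlinarith
    nlinarith
  have h7 : r ^ 2 * x t ≤ r ^ 2 * (3 / 5) := by nlinarith
  exact le_of_mul_le_mul_left h7 (by positivity)

/-- Replacing the edges outside the core at the vertices of `R` (those missing part of the core) by
all edges to the core increases the quadratic form. A removed edge at a centre (a vertex of `T`) is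
charged to its other end, and any other removed edge to an end in `R`; then each vertex of `R` pays
for at most one centre and at most three other vertices, which weigh less than the missing core
vertex. -/
theorem quadForm_add_le {S : SimpleGraph V} [DecidableRel S.Adj] {R T : Finset V}
    (hx0 : ∀ u, 0 ≤ x u)
    (hRL : ∀ u ∈ R, u ∉ L)
    (hS : ∀ u w, u ≠ w → u ∈ L → S.Adj u w)
    (hGS : ∀ u w, u ∉ R → w ∉ R → G.Adj u w → S.Adj u w)
    (hR : ∀ u ∈ R, ∃ l ∈ L, ¬ G.Adj u l)
    (hT : ∀ t ∈ T, ∀ w, w ∉ L → G.Adj t w → w ∈ R)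
    (hcore : ∀ l ∈ L, 3 / 4 ≤ x l)
    (hone : ∀ u ∈ R, (G.neighborFinset u ∩ T).card ≤ 1)
    (hthree : ∀ u ∈ R, u ∉ T → (G.neighborFinset u \ L).card ≤ 3)
    (hxT : ∀ t ∈ T, x t ≤ 3 / 5) (hxo : ∀ u, u ∉ L → u ∉ T → x u ≤ 1 / 54) :
    quadForm G x + 1 / 20 * ∑ u ∈ R, x u ≤ quadForm S x := by
  classical
  -- `c u w`: the edge `uw` of `G` is charged to `u`; `m u w`: the edge from `u` to the core vertex
  -- `w` is missing in `G`
  let c : V → V → Prop := fun u w =>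
    u ∈ R ∧ w ∉ L ∧ G.Adj u w ∧ (w ∈ T ∨ (u ∉ T ∧ w ∉ T))
  let m : V → V → Prop := fun u w => u ∈ R ∧ w ∈ L ∧ ¬ G.Adj u w
  let i : Prop → ℝ := fun P => if P then 1 else 0
  have hpt : ∀ u w, i (G.Adj u w) + i (m u w) + i (m w u) ≤
      i (S.Adj u w) + i (c u w) + i (c w u) := by
    intro u w
    have h1 : G.Adj u w → S.Adj u w ∨ c u w ∨ c w u := by
      intro huw
      by_cases huL : u ∈ L
      · exact Or.inl (hS u w huw.ne huL)
      by_cases hwL : w ∈ L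
      · exact Or.inl (hS w u huw.ne' hwL).symm
      by_cases huT : u ∈ T
      · exact Or.inr (Or.inr ⟨hT u huT w hwL huw, huL, huw.symm, Or.inl huT⟩)
      by_cases hwT : w ∈ T
      · exact Or.inr (Or.inl ⟨hT w hwT u huL huw.symm, hwL, huw, Or.inl hwT⟩)
      by_cases huR : u ∈ R
      · exact Or.inr (Or.inl ⟨huR, hwL, huw, Or.inr ⟨huT, hwT⟩⟩)
      by_cases hwR : w ∈ R
      · exact Or.inr (Or.inr ⟨hwR, huL, huw.symm, Or.inr ⟨hwT, huT⟩⟩)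
      exact Or.inl (hGS u w huR hwR huw)
    have hmS : ∀ {u w}, m u w → S.Adj u w ∧ ¬ G.Adj u w ∧ ¬ m w u := by
      rintro u w ⟨huR, hwL, huw⟩
      refine ⟨(hS w u ?_ hwL).symm, huw, fun h => hRL w h.1 hwL⟩
      rintro rfl
      exact hRL w huR hwL
    have h2 : m u w → S.Adj u w ∧ ¬ G.Adj u w ∧ ¬ m w u := hmS
    have h3 : m w u → S.Adj u w ∧ ¬ G.Adj u w ∧ ¬ m u w := fun h =>
      ⟨(hmS h).1.symm, fun h' => (hmS h).2.1 h'.symm, (hmS h).2.2⟩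
    generalize G.Adj u w = g at *
    generalize S.Adj u w = s at *
    generalize m u w = m₁ at *
    generalize m w u = m₂ at *
    generalize c u w = c₁ at *
    generalize c w u = c₂ at *
    simp only [i]
    split_ifs <;> first | norm_num; done | (exfalso; tauto)
  have hsum : quadForm G x + 2 * ∑ u, x u * ∑ w, i (m u w) * x w ≤
      quadForm S x + 2 * ∑ u, x u * ∑ w, i (c u w) * x w := by
    have hsym : ∀ P : V → V → Prop, 2 * ∑ u, x u * ∑ w, i (P u w) * x w =
        ∑ u, ∑ w, (i (P u w) + i (P w u)) * (x u * x w) := by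
      intro P
      simp only [add_mul, Finset.sum_add_distrib]
      rw [Finset.sum_comm (f := fun u w => i (P w u) * (x u * x w)), two_mul]
      congr 1 <;>
      · refine Finset.sum_congr rfl fun u _ => ?_
        rw [Finset.mul_sum]
        exact Finset.sum_congr rfl fun w _ => by ring
    have hquad : ∀ (H : SimpleGraph V) [DecidableRel H.Adj], quadForm H x =
        ∑ u, ∑ w, i (H.Adj u w) * (x u * x w) := by
      intro H _
      refine Finset.sum_congr rfl fun u _ => Finset.sum_congr rfl fun w _ => ?_
      by_cases h : H.Adj u w <;> simp [i, h]
    rw [hsym, hsym, hquad, hquad, ← Finset.sum_add_distrib, ← Finset.sum_add_distrib]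
    refine Finset.sum_le_sum fun u _ => ?_
    rw [← Finset.sum_add_distrib, ← Finset.sum_add_distrib]
    refine Finset.sum_le_sum fun w _ => ?_
    rw [← add_mul, ← add_mul, ← add_assoc, ← add_assoc]
    exact mul_le_mul_of_nonneg_right (hpt u w) (mul_nonneg (hx0 u) (hx0 w))
  have hu : ∀ u ∈ R, ∑ w, i (c u w) * x w + 1 / 20 ≤ ∑ w, i (m u w) * x w := by
    intro u hu
    have h1 : 3 / 4 ≤ ∑ w, i (m u w) * x w := by
      obtain ⟨l, hl, hul⟩ := hR u hu
      refine (hcore l hl).trans ?_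
      have := Finset.single_le_sum (f := fun w => i (m u w) * x w) (s := Finset.univ)
        (fun w _ => mul_nonneg (by simp only [i]; split_ifs <;> norm_num) (hx0 w))
        (Finset.mem_univ l)
      simpa [i, m, hl, hul, hu] using this
    have h2 : ∑ w, i (c u w) * x w = ∑ w with c u w, x w := by
      simp [i, Finset.sum_filter]
    have h3 : ∑ w with c u w, x w ≤ ∑ w ∈ G.neighborFinset u ∩ T, x w +
        ∑ w with c u w ∧ w ∉ T, x w := by
      rw [← Finset.sum_inter_add_sum_sdiff _ T]
      refine add_le_add (Finset.sum_le_sum_of_subset_of_nonneg (fun w hw => ?_)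
        fun w _ _ => hx0 w) (le_of_eq (Finset.sum_congr ?_ fun _ _ => rfl))
      · simp only [Finset.mem_inter, Finset.mem_filter, Finset.mem_univ, true_and, c] at hw
        simp [hw.1.2.2.1, hw.2]
      · ext w
        simp
    have h4 : ∑ w ∈ G.neighborFinset u ∩ T, x w ≤ 3 / 5 := by
      refine (Finset.sum_le_card_nsmul _ _ (3 / 5 : ℝ) fun w hw =>
        hxT w (Finset.mem_inter.1 hw).2).trans ?_
      have : ((G.neighborFinset u ∩ T).card : ℝ) ≤ 1 := by exact_mod_cast hone u hu
      rw [nsmul_eq_mul]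
      linarith
    have h5 : ∑ w with c u w ∧ w ∉ T, x w ≤ 3 / 54 := by
      by_cases huT : u ∈ T
      · rw [Finset.filter_false_of_mem]
        · norm_num
        · simp only [c]
          tauto
      refine (Finset.sum_le_card_nsmul _ _ (1 / 54 : ℝ) fun w hw => ?_).trans ?_
      · simp only [Finset.mem_filter, c] at hw
        exact hxo w hw.2.1.2.1 hw.2.2
      · have h : (Finset.univ.filter fun w => c u w ∧ w ∉ T).card ≤ 3 := by
          refine (Finset.card_le_card fun w hw => ?_).trans (hthree u hu huT)
          simp only [Finset.mem_filter, c] at hw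
          simp [hw.2.1.2.1, hw.2.1.2.2.1]
        have h' : ((Finset.univ.filter fun w => c u w ∧ w ∉ T).card : ℝ) ≤ 3 := by exact_mod_cast h
        rw [nsmul_eq_mul]
        linarith
    linarith
  have hfin : ∑ u, x u * ∑ w, i (c u w) * x w + 1 / 20 * ∑ u ∈ R, x u ≤
      ∑ u, x u * ∑ w, i (m u w) * x w := by
    have : ∑ u ∈ R, x u = ∑ u, if u ∈ R then x u else 0 := by simp
    rw [this, Finset.mul_sum, ← Finset.sum_add_distrib]
    refine Finset.sum_le_sum fun u _ => ?_
    by_cases huR : u ∈ R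
    · have := mul_le_mul_of_nonneg_left (hu u huR) (hx0 u)
      rw [if_pos huR]
      linarith
    · simp [huR, i, c, m]
  have hRnonneg : 0 ≤ ∑ u ∈ R, x u := Finset.sum_nonneg fun u _ => hx0 u
  linarith

end Comparison

/-! ### The extremal graph -/

section Extremal

/-- A forest-free graph with spectral radius at least that of all graphs `S⁺` built on its core is
itself one of them. -/
theorem exists_eq_coreGraph {V : Type*} [Fintype V] [DecidableEq V] {G : SimpleGraph V}
    [DecidableRel G.Adj] {k : ℕ} {x : V → ℝ} {r q : ℝ} {L : Finset V} (hfree : (forest k).Free G)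
    (hx0 : ∀ u, 0 ≤ x u) (hx1 : ∀ u, x u ≤ 1) {v : V} (hv : x v = 1)
    (hx : ∀ u, ∑ w ∈ G.neighborFinset u, x w = r * x u) (hk : 1 ≤ k) (hq : q = k + 8)
    (hn : 9 * q ^ 4 + q ≤ Fintype.card V) (hr1 : 6 * q ^ 2 ≤ r)
    (hr3 : ((k : ℝ) + 3) * (Fintype.card V - (k + 3)) ≤ r ^ 2)
    (hLcard : L.card = k + 3) (hcore : ∀ l ∈ L, 3 / 4 ≤ x l)
    (hL : 4 * (Finset.univ.filter fun w => ∃ l ∈ L, ¬ G.Adj l w).card ≤ Fintype.card V)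
    (hrho : ∀ a b, a ≠ b → a ∉ L → b ∉ L → rho (coreGraph L a b) ≤ r) :
    ∃ a b, a ≠ b ∧ a ∉ L ∧ b ∉ L ∧ G = coreGraph L a b := by
  classical
  have hk1 : (1 : ℝ) ≤ k := by exact_mod_cast hk
  have hq9 : 9 ≤ q := by linarith
  have hr0 : 0 < r := by nlinarith
  have : Nonempty V := ⟨v⟩
  have hnk : 100 * (k + 8) ≤ Fintype.card V := by
    have : 100 * ((k : ℝ) + 8) ≤ Fintype.card V := by
      rw [← hq]
      nlinarith [mul_le_mul_of_nonneg_left (show 81 ≤ q ^ 2 by nlinarith) (sq_nonneg q)]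
    exact_mod_cast this
  have hcodeg : ∀ u ∈ L, ∀ v ∈ L, 5 * k + 15 ≤ codeg G u v := fun u hu v hv => by
    have := le_codeg_of_core hL hu hv
    omega
  have hP : ∀ p, IsP5 G p → ∃ i, p i ∈ L := fun p hp => by
    by_contra hcon
    push Not at hcon
    exact hfree (isContained_of_common hLcard hcodeg hp v fun i hi => absurd hi (hcon i))
  have hLq : (L.card : ℝ) + 3 ≤ q := by
    rw [hLcard]
    push_cast
    linarith
  obtain ⟨a, b, hab, ha, hb, hpair⟩ := exists_pair_of_full hfree hLcard hcodeg (by omega)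
  refine ⟨a, b, hab, ha, hb, ?_⟩
  set S := coreGraph L a b with hSdef
  set R := Finset.univ.filter fun u => u ∉ L ∧ ∃ l ∈ L, ¬ G.Adj l u with hRdef
  have hRfull : ∀ u, u ∉ L → u ∉ R → ∀ l ∈ L, G.Adj l u := by
    intro u hu huR l hl
    by_contra h
    exact huR (Finset.mem_filter.2 ⟨Finset.mem_univ _, hu, l, hl, h⟩)
  have hS : ∀ u w, u ≠ w → u ∈ L → S.Adj u w := fun u w huw hu => ⟨huw, Or.inl hu⟩
  have hGS : ∀ u w, u ∉ R → w ∉ R → G.Adj u w → S.Adj u w := by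
    intro u w hu hw huw
    refine ⟨huw.ne, ?_⟩
    by_cases huL : u ∈ L
    · exact Or.inl huL
    by_cases hwL : w ∈ L
    · exact Or.inr (Or.inl hwL)
    exact Or.inr (Or.inr (hpair u w huL hwL (hRfull u huL hu) (hRfull w hwL hw) huw))
  have hT : ∀ t ∈ centers G L, ∀ w, w ∉ L → G.Adj t w → w ∈ R := by
    intro t ht w hw htw
    by_contra hwR
    obtain ⟨htL, ht4⟩ := mem_centers.1 ht
    obtain ⟨c, hc, hcw⟩ := Finset.exists_mem_ne (show 1 < (G.neighborFinset t \ L).card by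
      unfold outDeg at ht4; omega) w
    rw [Finset.mem_sdiff, SimpleGraph.mem_neighborFinset] at hc
    exact false_of_path_outside hfree hLcard hcodeg hw (hRfull w hw hwR) htL hc.2 htw.symm hc.1
      hcw.symm
  have hRcard : 4 * R.card ≤ Fintype.card V := by
    refine le_trans (Nat.mul_le_mul_left 4 (Finset.card_le_card fun u hu => ?_)) hL
    rw [hRdef, Finset.mem_filter] at hu
    exact Finset.mem_filter.2 ⟨Finset.mem_univ _, hu.2.2⟩
  have hle : quadForm G x + 1 / 20 * ∑ u ∈ R, x u ≤ quadForm S x := by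
    refine quadForm_add_le (L := L) (T := centers G L) hx0
      (fun u hu => (Finset.mem_filter.1 hu).2.1) hS hGS (fun u hu => ?_) hT hcore
      (fun u hu => ?_) (fun u hu huT => ?_) (fun t ht => ?_)
      fun u hu huT => ?_
    · obtain ⟨l, hl, h⟩ := (Finset.mem_filter.1 hu).2.2
      exact ⟨l, hl, fun h' => h h'.symm⟩
    · exact card_inter_centers_le_one hP (Finset.mem_filter.1 hu).2.1
    · by_contra hcon
      refine huT (mem_centers.2 ⟨(Finset.mem_filter.1 hu).2.1, ?_⟩)
      unfold outDeg
      omega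
    · refine weight_le_of_mem_centers hP hLcard hx1 hx hk hq hn hr1 hr3 ht ?_
      refine le_trans (Nat.mul_le_mul_left 4 (Finset.card_le_card fun w hw => ?_)) hRcard
      rw [Finset.mem_sdiff, SimpleGraph.mem_neighborFinset] at hw
      exact hT t ht w hw.2 hw.1
    · have := weight_le_of_notMem_centers hx0 hx1 hx hLq hr1 hu huT
      nlinarith [hx0 u]
  have hRsum : 0 ≤ ∑ u ∈ R, x u := Finset.sum_nonneg fun u _ => hx0 u
  have hsq : 0 < ∑ u, x u ^ 2 := Finset.sum_pos' (fun u _ => sq_nonneg _)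
    ⟨v, Finset.mem_univ _, by rw [hv]; norm_num⟩
  have hGr := quadForm_eq_of_eigenvector G hx
  have hSr := quadForm_le S x
  have hρ := hrho a b hab ha hb
  have hρ' := mul_le_mul_of_nonneg_right hρ hsq.le
  have hSpos : 0 < rho S := by
    have : r * ∑ u, x u ^ 2 ≤ rho S * ∑ u, x u ^ 2 := by linarith
    exact hr0.trans_le (le_of_mul_le_mul_right this hsq)
  have heig := eigenvector_of_le_quadForm S x (by linarith)
  obtain ⟨l, hl⟩ := Finset.card_pos.1 (show 0 < L.card by omega)
  have hpos := pos_of_dominating hx0 (v := v) (by rw [hv]; norm_num)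
    (fun u hu => hS l u hu.symm hl) hSpos heig
  have hRempty : ∀ u, u ∉ R := by
    intro u hu
    have h1 := Finset.single_le_sum (f := x) (fun u _ => hx0 u) hu
    linarith [hpos u]
  exact eq_of_quadForm_le (fun u w huw => hGS u w (hRempty u) (hRempty w) huw) hpos (by linarith)

theorem le_sq_rho_sPlus {n h : ℕ} (hh : 0 < h) (hn : h + 2 ≤ n) :
    0 ≤ rho (sPlus n h) ∧ (h : ℝ) * (n - h) ≤ rho (sPlus n h) ^ 2 := by
  classical
  have : Nonempty (Fin h ⊕ (Fin 2 ⊕ Fin (n - h - 2))) := ⟨Sum.inl ⟨0, hh⟩⟩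
  obtain ⟨m, rfl⟩ : ∃ m, n = h + 2 + m := ⟨n - (h + 2), by omega⟩
  have hm : h + 2 + m - h - 2 = m := by omega
  have hcast : ((h + 2 + m : ℕ) : ℝ) - h = m + 2 := by push_cast; ring
  rw [hcast]
  set c : ℝ := (m : ℝ) + 2 with hc
  have hc0 : 0 < c := by positivity
  have hh0 : (0 : ℝ) < h := by exact_mod_cast hh
  -- the test vector is the Perron vector of the complete bipartite graph between core and rest
  let y : Fin h ⊕ (Fin 2 ⊕ Fin (h + 2 + m - h - 2)) → ℝ := Sum.elim (fun _ => √c) fun _ => √h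
  have hsc : √c ^ 2 = c := Real.sq_sqrt hc0.le
  have hsh : √(h : ℝ) ^ 2 = h := Real.sq_sqrt hh0.le
  have hsq : ∑ u, y u ^ 2 = 2 * h * c := by
    simp only [y, Fintype.sum_sum_type, Sum.elim_inl, Sum.elim_inr, hsc, hsh, Finset.sum_const,
      Finset.card_univ, Fintype.card_sum, Fintype.card_fin, nsmul_eq_mul, hm]
    push_cast
    rw [hc]
    ring
  have hle : 2 * h * c * (√h * √c) ≤ quadForm (sPlus (h + 2 + m) h) y := by
    have h1 : ∀ i : Fin h, c * (√h * √c) ≤ ∑ w, if (sPlus (h + 2 + m) h).Adj (Sum.inl i) w then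
        y (Sum.inl i) * y w else 0 := by
      intro i
      rw [Fintype.sum_sum_type]
      refine le_add_of_nonneg_of_le (Finset.sum_nonneg fun w _ => ?_) ?_
      · simp only [y, Sum.elim_inl]
        split_ifs <;> positivity
      · simp only [y, sPlus, join, SimpleGraph.sup_adj, completeBipartiteGraph_adj, Sum.isLeft_inl,
          Sum.isRight_inr, Sum.elim_inl, Sum.elim_inr, and_self, true_or, or_true, if_true,
          Finset.sum_const, Finset.card_univ, Fintype.card_sum, Fintype.card_fin, nsmul_eq_mul, hm]
        apply le_of_eq
        push_cast
        rw [hc]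
        ring
    have h2 : ∀ b, h * (√h * √c) ≤ ∑ w, if (sPlus (h + 2 + m) h).Adj (Sum.inr b) w then
        y (Sum.inr b) * y w else 0 := by
      intro b
      rw [Fintype.sum_sum_type]
      refine le_add_of_le_of_nonneg ?_ (Finset.sum_nonneg fun w _ => ?_)
      · simp [y, sPlus, join]
      · simp only [y, Sum.elim_inr]
        split_ifs <;> positivity
    rw [quadForm, Fintype.sum_sum_type]
    have h3 := Finset.card_nsmul_le_sum Finset.univ _ _ fun i _ => h1 i
    have h4 := Finset.card_nsmul_le_sum Finset.univ _ _ fun b _ => h2 b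
    simp only [Finset.card_univ, Fintype.card_sum, Fintype.card_fin, nsmul_eq_mul, hm] at h3 h4
    push_cast at h4
    rw [add_comm (2 : ℝ), ← hc] at h4
    linarith
  have h5 : 2 * h * c * (√h * √c) ≤ 2 * h * c * rho (sPlus (h + 2 + m) h) := by
    have := hle.trans (quadForm_le _ y)
    rw [hsq] at this
    linarith
  have h6 : √h * √c ≤ rho (sPlus (h + 2 + m) h) := le_of_mul_le_mul_left h5 (by positivity)
  have h7 : 0 ≤ √h * √c := by positivity
  refine ⟨h7.trans h6, ?_⟩
  calc (h : ℝ) * c = (√h * √c) ^ 2 := by rw [mul_pow, hsc, hsh]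
    _ ≤ _ := by gcongr

theorem pow_six_le {k : ℕ} (hk : 1 ≤ k) : (k + 8) ^ 6 + 9 * (k + 8) ≤ 9 * 2 ^ (4 * (k + 3)) := by
  induction k, hk using Nat.le_induction with
  | base => norm_num
  | succ k hk ih =>
    have h : (k + 1 + 8) ^ 6 + 9 * (k + 1 + 8) ≤ 16 * ((k + 8) ^ 6 + 9 * (k + 8)) := by
      have h1 : 9 * (k + 9) ≤ 10 * (k + 8) := by omega
      have h2 := Nat.pow_le_pow_left h1 6
      rw [mul_pow, mul_pow] at h2
      rw [show k + 1 + 8 = k + 9 by omega]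
      omega
    calc _ ≤ _ := h
      _ ≤ 16 * (9 * 2 ^ (4 * (k + 3))) := Nat.mul_le_mul_left _ ih
      _ = _ := by ring

theorem nonempty_iso_sPlus {k n : ℕ} (hk : 1 ≤ k) (hn : 2 ^ (4 * (k + 3)) ≤ n)
    {G : SimpleGraph (Fin n)} (hfree : (forest k).Free G)
    (hrho : rho (sPlus n (k + 3)) ≤ rho G) : Nonempty (G ≃g sPlus n (k + 3)) := by
  classical
  have hk1 : (1 : ℝ) ≤ k := by exact_mod_cast hk
  have hpow : (k + 8) ^ 6 + 9 * (k + 8) ≤ 9 * n := (pow_six_le hk).trans (by omega)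
  obtain ⟨q, hq⟩ : ∃ q : ℝ, q = k + 8 := ⟨_, rfl⟩
  have hq9 : 9 ≤ q := by linarith
  have hpow' : q ^ 6 + 9 * q ≤ 9 * n := by
    rw [hq]
    exact_mod_cast hpow
  have hn4 : 9 * q ^ 4 + q ≤ Fintype.card (Fin n) := by
    rw [Fintype.card_fin]
    nlinarith [mul_le_mul_of_nonneg_left (show 81 ≤ q ^ 2 by nlinarith)
      (show 0 ≤ q ^ 4 by positivity)]
  have hnk : k + 5 ≤ n := by
    have h1 := Nat.zero_le ((k + 8) ^ 6)
    omega
  have : NeZero n := ⟨by omega⟩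
  obtain ⟨x, hx0, hx1, ⟨v, hv⟩, hx⟩ := exists_nonneg_eigenvector G
  obtain ⟨hρ0, hρ⟩ := le_sq_rho_sPlus (n := n) (h := k + 3) (by omega) (by omega)
  have hr0 : 0 ≤ rho G := hρ0.trans hrho
  have hr3 : ((k : ℝ) + 3) * (Fintype.card (Fin n) - (k + 3)) ≤ rho G ^ 2 := by
    rw [Fintype.card_fin]
    push_cast at hρ
    exact hρ.trans (by gcongr)
  have hr2 : 2 * q ^ 3 ≤ 3 * rho G := by
    refine le_of_sq_le_sq ?_ (by positivity)
    have h1 : 4 * ((n : ℝ) - (k + 3)) ≤ rho G ^ 2 := by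
      refine le_trans ?_ hr3
      rw [Fintype.card_fin]
      have : (k : ℝ) + 5 ≤ n := by exact_mod_cast hnk
      nlinarith
    nlinarith
  have hr1 : 6 * q ^ 2 ≤ rho G := by nlinarith
  obtain ⟨L, hLcard, hcore, hL⟩ := exists_core hfree hx0 hx1 hv hx hk hq hn4 hr1 hr2 hr3
  obtain ⟨a, b, hab, ha, hb, hG⟩ := exists_eq_coreGraph hfree hx0 hx1 hv hx hk hq hn4 hr1 hr3 hLcard
    hcore hL fun a b hab ha hb => by
      obtain ⟨e⟩ := nonempty_coreGraph_iso hLcard hab ha hb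
      rw [rho_eq_of_iso e]
      exact hrho
  rw [hG]
  exact nonempty_coreGraph_iso hLcard hab ha hb

end Extremal

end SpectralForest

theorem mainTheorem4 (k n : ℕ) (hk : 1 ≤ k)
    (hn : max (2 ^ (4 * (k + 3))) ((21 * k + 38) ^ 2) ≤ n) :
    SpectralForest.exSp n (SpectralForest.forest k) =
      {G : SimpleGraph (Fin n) | Nonempty (G ≃g SpectralForest.sPlus n (k + 3))} := by
  have hn' := (le_max_left _ _).trans hn
  ext G
  constructor
  · rintro ⟨hfree, hmax⟩
    have hnk : k + 5 ≤ n := by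
      have h1 := Nat.zero_le ((k + 8) ^ 6)
      have h2 := SpectralForest.pow_six_le hk
      omega
    let f : Fin n ≃ Fin (k + 3) ⊕ (Fin 2 ⊕ Fin (n - (k + 3) - 2)) :=
      Fintype.equivOfCardEq (by simp only [Fintype.card_sum, Fintype.card_fin]; omega)
    let e := SimpleGraph.Iso.comap f (SpectralForest.sPlus n (k + 3))
    refine SpectralForest.nonempty_iso_sPlus hk hn' hfree ?_
    rw [← SpectralForest.rho_eq_of_iso e]
    exact hmax _ fun h => SpectralForest.forest_free_sPlus n k (h.trans ⟨e.toCopy⟩)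
  · rintro ⟨e⟩
    refine ⟨fun h => SpectralForest.forest_free_sPlus n k (h.trans ⟨e.toCopy⟩), fun G' hG' => ?_⟩
    rw [SpectralForest.rho_eq_of_iso e]
    by_contra! hlt
    obtain ⟨e'⟩ := SpectralForest.nonempty_iso_sPlus hk hn' hG' hlt.le
    exact hlt.ne' (SpectralForest.rho_eq_of_iso e')
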